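/- Let $\mu$ be a probability law on $[0,\infty)$ with mean $1$ (the fading law) and $N_0\ge 0$ (the noise power). Let $L(r)\ge 0$, $r\ge 0$, be a measurable path loss function, either deterministic or depending on a random link state $s$ of some law $\nu$ (so $L(r)=L(r,s)$, jointly measurable), such that, for a finite constant $L_0$, almost surely in $s$: $L(0)=L_0$ and $L(r)\le L_0$ for each $r\ge 0$; moreover $\gamma:=\mathbb E\int_0^\infty r\,L(r)\,dr\in(0,\infty)$ (just $\int_0^\infty rL(r)\,dr$ in the deterministic case), and $\mathbb E[L(r)]\to L_0$ as $r\downarrow 0$ (in the deterministic case: $L$ is continuous at $0$). For $\lambda>0$ let $\Phi_\lambda=\{x_n\}$ be a homogeneous Poisson point process of intensity $\lambda$ in $\mathbb R^2$ (the base stations), whose points carry i.i.d. marks $(h_n,s_n)$ of law $\mu\otimes\nu$, independent of $\Phi_\lambda$. Let $x_{0}$ denote the point of $\Phi_\lambda$ nearest to the origin, with distance $r_0=|x_0|$ and mark $(h_0,s_0)$, and put $$\mathcal I_\lambda=\sum_{n:\,|x_n|>r_0}h_n\,L(|x_n|,s_n),\qquad \mathrm{SINR}(\lambda)=\frac{h_0\,L(r_0,s_0)}{\mathcal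 I_\lambda+N_0}.$$ Suppose that for some constant $\lambda_c\ge 0$ the second negative moment $\mathbb E[\mathcal I_{\lambda_0}^{-2}]$ is finite for every $\lambda_0>0$ with $\lambda_0\ge\lambda_c$. Then the average area spectral efficiency satisfies $$\lim_{\lambda\to\infty}\lambda\,\mathbb E\big[\log_2(1+\mathrm{SINR}(\lambda))\big]=\frac{L_0}{2\pi\,\ln(2)\,\gamma},$$ where $\lambda\to\infty$ through the real numbers. -/

import Mathlib

open MeasureTheory ProbabilityTheory Filter Topology
open scoped ENNReal NNReal

noncomputable section

namespace Ultradense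

/-- The Euclidean plane, in which the base stations live. The typical user is at the origin. -/
abbrev Plane : Type := EuclideanSpace ℝ (Fin 2)

/-- The counting measure `∑ₙ δ_{x n}` of a sequence of points of the plane. -/
def countingMeasure (x : ℕ → Plane) : Measure Plane :=
  Measure.sum fun n => Measure.dirac (x n)

/-- The random points `X 0, X 1, …` form (an enumeration of) a homogeneous Poisson point process
of intensity `lam` in the plane: the number of points in a bounded Borel set is Poisson with mean
`lam * area`, and the numbers of points in disjoint bounded Borel sets are independent. -/
structure IsPoissonProcess {Ω : Type*} [MeasurableSpace Ω] (P : Measure Ω) (lam : ℝ≥0)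
    (X : ℕ → Ω → Plane) : Prop where
  measurable : ∀ n, Measurable (X n)
  hasLaw_count : ∀ B : Set Plane, MeasurableSet B → Bornology.IsBounded B →
    HasLaw (fun ω => countingMeasure (fun n => X n ω) B)
      ((poissonMeasure (lam * (volume B).toNNReal)).map (Nat.cast : ℕ → ℝ≥0∞)) P
  indep_count : ∀ (k : ℕ) (B : Fin k → Set Plane), (∀ i, MeasurableSet (B i)) →
    (∀ i, Bornology.IsBounded (B i)) → Pairwise (fun i j => Disjoint (B i) (B j)) →
    iIndepFun (fun i ω => countingMeasure (fun n => X n ω) (B i)) P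

/-- The downlink network of intensity `lam`: base stations `X n` form a Poisson process; the links
to the user at the origin carry independent marks, consisting of a fading gain `H n` of law `μ` and
a link state `T n` of law `ν` (e.g. line of sight or not), which are independent of each other, of
the marks of the other links, and of the positions. -/
structure IsNetwork {Ω S : Type*} [MeasurableSpace Ω] [MeasurableSpace S] (P : Measure Ω)
    (lam : ℝ≥0) (μ : Measure ℝ≥0) (ν : Measure S)
    (X : ℕ → Ω → Plane) (H : ℕ → Ω → ℝ≥0) (T : ℕ → Ω → S) : Prop where
  poisson : IsPoissonProcess P lam X
  measurable_fading : ∀ n, Measurable (H n)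
  measurable_state : ∀ n, Measurable (T n)
  law_mark : ∀ n, P.map (fun ω => (H n ω, T n ω)) = μ.prod ν
  indep_mark : iIndepFun (fun n ω => (H n ω, T n ω)) P
  indep_position : IndepFun (fun ω n => X n ω) (fun ω n => (H n ω, T n ω)) P

/-- `γ = 𝔼 ∫₀^∞ r L(r) dr`, the expectation being over the link state. When `L` does not depend on
the link state, this is `∫₀^∞ r L(r) dr`. -/
def gammaConst {S : Type*} [MeasurableSpace S] (ν : Measure S) (L : ℝ≥0 → S → ℝ≥0) : ℝ≥0∞ :=
  ∫⁻ s, (∫⁻ r in Set.Ioi (0 : ℝ), ENNReal.ofReal r * (L r.toNNReal s : ℝ≥0∞)) ∂ν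

/-- Physically feasible path loss, possibly depending on a random link state of law `ν`;
`L r s` is the path loss at distance `r` in state `s`. -/
structure IsFeasiblePathLoss {S : Type*} [MeasurableSpace S] (ν : Measure S)
    (L : ℝ≥0 → S → ℝ≥0) (L₀ : ℝ≥0) : Prop where
  measurable : Measurable (Function.uncurry L)
  at_zero : ∀ᵐ s ∂ν, L 0 s = L₀
  le : ∀ r, ∀ᵐ s ∂ν, L r s ≤ L₀
  gamma_pos : 0 < gammaConst ν L
  gamma_lt_top : gammaConst ν L < ⊤

/-- Index of the serving base station: the one nearest to the origin (for a Poisson process it is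
almost surely unique). -/
def servingIndex (x : ℕ → Plane) : ℕ :=
  sInf {n | ∀ m, ‖x n‖ ≤ ‖x m‖}

section Config

variable {S : Type*}

/-- Power `h L(r)` received by the user at the origin from the `n`-th base station. -/
def rxPower (L : ℝ≥0 → S → ℝ≥0) (x : ℕ → Plane) (h : ℕ → ℝ≥0) (t : ℕ → S) (n : ℕ) : ℝ≥0∞ :=
  (h n : ℝ≥0∞) * (L ‖x n‖₊ (t n) : ℝ≥0∞)

/-- Interference: the total power received from the base stations outside the closed disc around
the origin whose radius is the distance to the serving base station. -/
def interference (L : ℝ≥0 → S → ℝ≥0) (x : ℕ → Plane) (h : ℕ → ℝ≥0) (t : ℕ → S) : ℝ≥0∞ :=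
  ∑' n, Set.indicator {n | ‖x (servingIndex x)‖ < ‖x n‖} (rxPower L x h t) n

/-- The signal-to-interference-plus-noise ratio of the user at the origin. -/
def sinr (L : ℝ≥0 → S → ℝ≥0) (N₀ : ℝ≥0) (x : ℕ → Plane) (h : ℕ → ℝ≥0) (t : ℕ → S) : ℝ≥0∞ :=
  rxPower L x h t (servingIndex x) / (interference L x h t + N₀)

end Config

/-- `log₂ (1 + z)` for `z ∈ [0, ∞]`. -/
def spectralEfficiency (z : ℝ≥0∞) : ℝ≥0∞ :=
  if z = ⊤ then ⊤ else ENNReal.ofReal (Real.logb 2 (1 + z.toReal))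

/-- The average area spectral efficiency `λ 𝔼[log₂ (1 + SINR)]`. -/
def averageASE {Ω S : Type*} [MeasurableSpace Ω] (P : Measure Ω) (lam : ℝ≥0)
    (L : ℝ≥0 → S → ℝ≥0) (N₀ : ℝ≥0)
    (X : ℕ → Ω → Plane) (H : ℕ → Ω → ℝ≥0) (T : ℕ → Ω → S) : ℝ≥0∞ :=
  (lam : ℝ≥0∞) *
    ∫⁻ ω, spectralEfficiency (sinr L N₀ (fun n => X n ω) (fun n => H n ω) (fun n => T n ω)) ∂P

/-- The second negative moment `𝔼[I⁻²]` of the interference (with `0⁻¹ = ∞`). -/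
def secondNegativeMoment {Ω S : Type*} [MeasurableSpace Ω] (P : Measure Ω)
    (L : ℝ≥0 → S → ℝ≥0)
    (X : ℕ → Ω → Plane) (H : ℕ → Ω → ℝ≥0) (T : ℕ → Ω → S) : ℝ≥0∞ :=
  ∫⁻ ω, (interference L (fun n => X n ω) (fun n => H n ω) (fun n => T n ω))⁻¹ ^ 2 ∂P

end Ultradense

end

noncomputable section

namespace Ultradense

set_option linter.unusedSectionVars false

/-! Write `A` for the signal and `I` for the interference. Frullani's integral gives `log (1 + A /
(I + N₀)) = ∫₀^∞ e^{-z(I + N₀)} (1 - e^{-zA}) / z dz`, so that only the joint transform of `A` and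
`e^{-zI}` is needed.

Positions are recorded by the disc area `v = π r²`, which turns the process of distances into a
Poisson process of rate `λ` on the half-line. With `u_z(v)` the Laplace transform of the power
received from area `v`, independence of the marks and the Laplace functional of the process give
`𝔼[f(A) e^{-zI}] = ∫₀^∞ 𝔼[f(g_v)] λ exp (-λ (v + ∫_v^∞ (1 - u_z))) dv`, where `g_v` is that power
(`IsNetwork.lintegral_mul_expNeg_interference`).

Take `f(a) = (1 - e^{-za}) / z` and substitute `z = t/λ`, `v = w/λ`. The two Jacobians absorb the
factor `λ` in front and the `λ` of the density, and since `1 - u_z` is `z` times the truncated gain,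
the exponent becomes `w + t ∫_{w/λ}^∞` of the truncated gain (`IsNetwork.log_two_mul_averageASE`).
As `λ → ∞` the integrand tends to `L₀ e^{-w - tΓ}` with `Γ = 2πγ`, and this integrates to `L₀ / Γ`
over the quadrant.

For domination, the exponent increases with `λ` (`scaledHazard_mono`) and the truncated gain is at
most `L₀`. So `L₀` times the exponential at one fixed `λ₁` is a majorant for all `λ ≥ λ₁`, and by
the same computation with `f = 1` the integral of that exponential is `λ₁ 𝔼[1 / I_{λ₁}]`
(`IsNetwork.mul_lintegral_inv_interference`), finite because the second negative moment is. -/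

/-! ### The function `e⁻ˣ` on `[0, ∞]` -/

/-- `e⁻ˣ` for `x ∈ [0, ∞]`. -/
def expNeg (x : ℝ≥0∞) : ℝ≥0∞ := (EReal.exp (x : EReal))⁻¹

@[simp] lemma expNeg_zero : expNeg 0 = 1 := by simp [expNeg]

@[simp] lemma expNeg_top : expNeg ⊤ = 0 := by simp [expNeg]

lemma expNeg_add (x y : ℝ≥0∞) : expNeg (x + y) = expNeg x * expNeg y := by
  unfold expNeg
  rw [EReal.coe_ennreal_add, EReal.exp_add, ENNReal.mul_inv] <;> simp [EReal.coe_ennreal_ne_bot]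

lemma expNeg_antitone : Antitone expNeg := fun _ _ h =>
  ENNReal.inv_le_inv.2 (EReal.exp_monotone (EReal.coe_ennreal_le_coe_ennreal_iff.2 h))

lemma expNeg_le_one (x : ℝ≥0∞) : expNeg x ≤ 1 := by
  simpa using expNeg_antitone (zero_le (a := x))

lemma expNeg_ne_top (x : ℝ≥0∞) : expNeg x ≠ ⊤ :=
  ((expNeg_le_one x).trans_lt ENNReal.one_lt_top).ne

lemma expNeg_ne_zero {x : ℝ≥0∞} (hx : x ≠ ⊤) : expNeg x ≠ 0 := by
  simpa [expNeg] using hx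

lemma continuous_expNeg : Continuous expNeg :=
  (ENNReal.continuous_exp.comp continuous_coe_ennreal_ereal).inv

@[fun_prop] lemma measurable_expNeg : Measurable expNeg := continuous_expNeg.measurable

lemma expNeg_ofReal {x : ℝ} (hx : 0 ≤ x) :
    expNeg (ENNReal.ofReal x) = ENNReal.ofReal (Real.exp (-x)) := by
  rw [expNeg, EReal.coe_ennreal_ofReal, max_eq_left hx, EReal.exp_coe, Real.exp_neg,
    ENNReal.ofReal_inv_of_pos (Real.exp_pos x)]

lemma expNeg_eq_ofReal {x : ℝ≥0∞} (hx : x ≠ ⊤) :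
    expNeg x = ENNReal.ofReal (Real.exp (-x.toReal)) := by
  rw [← expNeg_ofReal ENNReal.toReal_nonneg, ENNReal.ofReal_toReal hx]

lemma expNeg_sum {ι : Type*} (s : Finset ι) (f : ι → ℝ≥0∞) :
    expNeg (∑ i ∈ s, f i) = ∏ i ∈ s, expNeg (f i) := by
  classical
  induction s using Finset.induction_on with
  | empty => simp
  | insert a s ha ih => rw [Finset.sum_insert ha, Finset.prod_insert ha, expNeg_add, ih]

lemma tendsto_prod_expNeg (f : ℕ → ℝ≥0∞) :
    Tendsto (fun n => ∏ i ∈ Finset.range n, expNeg (f i)) atTop (𝓝 (expNeg (∑' n, f n))) := by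
  simp_rw [← expNeg_sum]
  exact (continuous_expNeg.tendsto _).comp ENNReal.summable.hasSum.tendsto_sum_nat

/-- `-log u`, as an element of `[0, ∞]`, for `u ∈ (0, 1]`. -/
def negLog (u : ℝ≥0∞) : ℝ≥0∞ := ENNReal.ofReal (-Real.log u.toReal)

@[fun_prop] lemma measurable_negLog : Measurable negLog := by
  unfold negLog; fun_prop

lemma expNeg_negLog {u : ℝ≥0∞} (h0 : u ≠ 0) (h1 : u ≤ 1) : expNeg (negLog u) = u := by
  have ht : u ≠ ⊤ := (h1.trans_lt ENNReal.one_lt_top).ne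
  have hpos : 0 < u.toReal := ENNReal.toReal_pos h0 ht
  have hle : u.toReal ≤ 1 := by simpa using ENNReal.toReal_mono ENNReal.one_ne_top h1
  rw [negLog, expNeg_ofReal (by linarith [Real.log_nonpos hpos.le hle]), neg_neg,
    Real.exp_log hpos, ENNReal.ofReal_toReal ht]

/-- The conventions `0⁻¹ = ⊤` and `⊤⁻¹ = 0` agree with the degenerate integrals, so `c` may be any
interference value. -/
lemma lintegral_expNeg_mul (c : ℝ≥0∞) :
    ∫⁻ z in Set.Ioi (0 : ℝ), expNeg (ENNReal.ofReal z * c) = c⁻¹ := by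
  rcases eq_or_ne c ⊤ with rfl | hc
  · rw [setLIntegral_congr_fun (g := fun _ => 0) measurableSet_Ioi]
    · simp
    · intro z hz
      simp [ENNReal.mul_top, show ENNReal.ofReal z ≠ 0 by simpa using hz]
  rcases eq_or_ne c 0 with rfl | hc0
  · simp
  have hpos : 0 < c.toReal := ENNReal.toReal_pos hc0 hc
  have h1 : ∫⁻ z in Set.Ioi (0 : ℝ), expNeg (ENNReal.ofReal z * c) =
      ∫⁻ z in Set.Ioi (0 : ℝ), ENNReal.ofReal (Real.exp (-c.toReal * z)) := by
    refine setLIntegral_congr_fun measurableSet_Ioi fun z hz => ?_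
    have hz : 0 < z := hz
    rw [expNeg_eq_ofReal (ENNReal.mul_ne_top ENNReal.ofReal_ne_top hc), ENNReal.toReal_mul,
      ENNReal.toReal_ofReal hz.le]
    ring_nf
  rw [h1, ← ofReal_integral_eq_lintegral_ofReal (integrableOn_exp_mul_Ioi (by linarith) 0)
    (ae_of_all _ fun _ => (Real.exp_pos _).le), integral_exp_mul_Ioi (by linarith) 0]
  simp only [mul_zero, Real.exp_zero, neg_div_neg_eq, one_div]
  rw [ENNReal.ofReal_inv_of_pos hpos, ENNReal.ofReal_toReal hc]

/-- `(1 - e⁻ˣ) / x`, written as an integral, for `x ∈ [0, ∞]`. -/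
def avgExp (x : ℝ≥0∞) : ℝ≥0∞ := ∫⁻ t in Set.Ioc (0 : ℝ) 1, expNeg (x * ENNReal.ofReal t)

lemma avgExp_antitone : Antitone avgExp := fun _ _ h =>
  lintegral_mono fun t => expNeg_antitone (by gcongr)

@[simp] lemma avgExp_zero : avgExp 0 = 1 := by simp [avgExp]

lemma avgExp_le_one (x : ℝ≥0∞) : avgExp x ≤ 1 := by
  simpa using avgExp_antitone (zero_le (a := x))

@[fun_prop] lemma measurable_avgExp : Measurable avgExp := avgExp_antitone.measurable

lemma tendsto_avgExp_zero : Tendsto avgExp (𝓝 0) (𝓝 1) := by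
  have h : Tendsto avgExp (𝓝 0) (𝓝 (∫⁻ t in Set.Ioc (0 : ℝ) 1, 1)) := by
    refine tendsto_lintegral_filter_of_dominated_convergence (fun _ => 1)
      (Eventually.of_forall fun x => ?_) (Eventually.of_forall fun x => ae_of_all _ fun t =>
        expNeg_le_one _) (by simp) (ae_of_all _ fun t => ?_)
    · fun_prop
    · have h1 : Tendsto (fun x : ℝ≥0∞ => x * ENNReal.ofReal t) (𝓝 0) (𝓝 (0 * ENNReal.ofReal t)) :=
        ENNReal.Tendsto.mul_const tendsto_id (Or.inr ENNReal.ofReal_ne_top)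
      simpa [Function.comp_def] using (continuous_expNeg.tendsto _).comp h1
  simpa using h

/-- Integrate the derivative of `-e^{-xt}` over `[0, 1]`. The identity fails at `⊤`, where the left
side is `0` and the right side is `1`. -/
lemma mul_avgExp {x : ℝ≥0∞} (hx : x ≠ ⊤) : x * avgExp x = 1 - expNeg x := by
  have hc : 0 ≤ x.toReal := ENNReal.toReal_nonneg
  have h1 : avgExp x = ∫⁻ t in Set.Ioc (0 : ℝ) 1, ENNReal.ofReal (Real.exp (-x.toReal * t)) := by
    refine setLIntegral_congr_fun measurableSet_Ioc fun t ht => ?_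
    rw [expNeg_eq_ofReal (ENNReal.mul_ne_top hx ENNReal.ofReal_ne_top), ENNReal.toReal_mul,
      ENNReal.toReal_ofReal ht.1.le]
    ring_nf
  have hint : IntegrableOn (fun t => Real.exp (-x.toReal * t)) (Set.Ioc 0 1) :=
    (Continuous.integrableOn_Icc (by fun_prop)).mono_set Set.Ioc_subset_Icc_self
  have h2 : x.toReal * ∫ t in (0 : ℝ)..1, Real.exp (-x.toReal * t) = 1 - Real.exp (-x.toReal) := by
    rw [← intervalIntegral.integral_const_mul]
    rw [intervalIntegral.integral_eq_sub_of_hasDerivAt (f := fun t => - Real.exp (-x.toReal * t))]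
    · simp; ring
    · intro t _
      have := ((hasDerivAt_id t).const_mul (-x.toReal)).exp.neg
      convert! this using 1
      simp; ring
    · exact Continuous.intervalIntegrable (by fun_prop) _ _
  rw [h1, ← ofReal_integral_eq_lintegral_ofReal hint (ae_of_all _ fun _ => (Real.exp_pos _).le),
    ← intervalIntegral.integral_of_le zero_le_one]
  nth_rewrite 1 [← ENNReal.ofReal_toReal hx]
  rw [← ENNReal.ofReal_mul hc, h2, ENNReal.ofReal_sub _ (Real.exp_pos _).le, expNeg_eq_ofReal hx,
    ENNReal.ofReal_one]

/-- The integrand is the `t`-derivative of `log (b + a t)`. -/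
lemma lintegral_div_add_mul {a b : ℝ≥0∞} (ha : a ≠ ⊤) (hb : b ≠ ⊤) (hb0 : b ≠ 0) :
    ∫⁻ t in Set.Ioc (0 : ℝ) 1, a * (b + a * ENNReal.ofReal t)⁻¹ =
      ENNReal.ofReal (Real.log (1 + (a / b).toReal)) := by
  have hA : 0 ≤ a.toReal := ENNReal.toReal_nonneg
  have hB : 0 < b.toReal := ENNReal.toReal_pos hb0 hb
  set A := a.toReal
  set B := b.toReal
  have hpos : ∀ t ∈ Set.Icc (0 : ℝ) 1, 0 < B + A * t := fun t ht => by nlinarith [ht.1]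
  have h1 : ∫⁻ t in Set.Ioc (0 : ℝ) 1, a * (b + a * ENNReal.ofReal t)⁻¹ =
      ∫⁻ t in Set.Ioc (0 : ℝ) 1, ENNReal.ofReal (A / (B + A * t)) := by
    refine setLIntegral_congr_fun measurableSet_Ioc fun t ht => ?_
    rw [div_eq_mul_inv, ENNReal.ofReal_mul hA,
      ENNReal.ofReal_inv_of_pos (hpos t ⟨ht.1.le, ht.2⟩), ENNReal.ofReal_add hB.le
      (mul_nonneg hA ht.1.le), ENNReal.ofReal_mul hA, ENNReal.ofReal_toReal ha,
      ENNReal.ofReal_toReal hb]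
  have hcont : ContinuousOn (fun t => A / (B + A * t)) (Set.Icc 0 1) :=
    ContinuousOn.div (by fun_prop) (by fun_prop) fun t ht => (hpos t ht).ne'
  have hint : IntegrableOn (fun t => A / (B + A * t)) (Set.Ioc 0 1) :=
    (hcont.integrableOn_Icc).mono_set Set.Ioc_subset_Icc_self
  rw [h1, ← ofReal_integral_eq_lintegral_ofReal hint, ← intervalIntegral.integral_of_le zero_le_one]
  · rw [intervalIntegral.integral_eq_sub_of_hasDerivAt (f := fun t => Real.log (B + A * t))]
    · rw [← Real.log_div (by simpa using (hpos 1 (by simp)).ne') (by simpa using hB.ne')]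
      congr 2
      rw [ENNReal.toReal_div]
      simp only [mul_one, mul_zero, add_zero]
      change (B + A) / B = 1 + A / B
      field_simp
    · intro t ht
      rw [Set.uIcc_of_le zero_le_one] at ht
      have := (((hasDerivAt_id t).const_mul A).const_add B).log (hpos t ht).ne'
      simpa using this
    · apply ContinuousOn.intervalIntegrable
      rwa [Set.uIcc_of_le zero_le_one]
  · exact (ae_restrict_iff' measurableSet_Ioc).2 (ae_of_all _ fun t ht =>
      div_nonneg hA (hpos t ⟨ht.1.le, ht.2⟩).le)

/-- Frullani-type representation of the logarithm: `∫₀^∞ e^{-zb} (1 - e^{-za}) / z dz` is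
`log (1 + a / b)`. -/
lemma lintegral_expNeg_mul_avgExp {a b : ℝ≥0∞} (ha : a ≠ ⊤) (hb0 : b ≠ 0) :
    ∫⁻ z in Set.Ioi (0 : ℝ),
        expNeg (ENNReal.ofReal z * b) * (a * avgExp (ENNReal.ofReal z * a)) =
      ENNReal.ofReal (Real.log 2) * spectralEfficiency (a / b) := by
  rcases eq_or_ne b ⊤ with rfl | hb
  · rw [setLIntegral_congr_fun (g := fun _ => 0) measurableSet_Ioi]
    · simp [spectralEfficiency, ENNReal.div_top]
    · intro z hz
      simp [ENNReal.mul_top, show ENNReal.ofReal z ≠ 0 by simpa using hz]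
  have hab : a / b ≠ ⊤ := (ENNReal.div_lt_top ha hb0).ne
  have hlog : 0 < Real.log 2 := Real.log_pos one_lt_two
  rw [spectralEfficiency, if_neg hab, ← ENNReal.ofReal_mul hlog.le, Real.logb,
    mul_div_cancel₀ _ hlog.ne', ← lintegral_div_add_mul ha hb hb0]
  have hm : Measurable fun p : ℝ × ℝ => a * expNeg (ENNReal.ofReal p.1 *
      (b + a * ENNReal.ofReal p.2)) :=
    by fun_prop
  -- Unfolding `avgExp` makes this a double integral of `a e^{-z(b + at)}`. By Tonelli the
  -- `z`-integral can be taken first and leaves `a / (b + at)`.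
  calc _ = ∫⁻ z in Set.Ioi (0 : ℝ), ∫⁻ t in Set.Ioc (0 : ℝ) 1,
          a * expNeg (ENNReal.ofReal z * (b + a * ENNReal.ofReal t)) := by
        refine lintegral_congr fun z => ?_
        rw [avgExp, ← lintegral_const_mul _ (by fun_prop),
          ← lintegral_const_mul _ (by fun_prop)]
        refine lintegral_congr fun t => ?_
        rw [mul_add, expNeg_add]
        ring_nf
    _ = ∫⁻ t in Set.Ioc (0 : ℝ) 1, ∫⁻ z in Set.Ioi (0 : ℝ),
          a * expNeg (ENNReal.ofReal z * (b + a * ENNReal.ofReal t)) :=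
        lintegral_lintegral_swap hm.aemeasurable
    _ = _ := by
        refine lintegral_congr fun t => ?_
        rw [lintegral_const_mul _ (by fun_prop), lintegral_expNeg_mul]

/-! ### Areas of discs and an exponential density on the half-line -/

/-- Area of the disc around the origin whose boundary contains `x`. -/
def discArea (x : Plane) : ℝ := Real.pi * ‖x‖ ^ 2

@[fun_prop] lemma measurable_discArea : Measurable discArea := by
  unfold discArea; fun_prop

lemma discArea_nonneg (x : Plane) : 0 ≤ discArea x := by
  unfold discArea; positivity

lemma discArea_le_iff {x y : Plane} : discArea x ≤ discArea y ↔ ‖x‖ ≤ ‖y‖ := by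
  unfold discArea
  rw [mul_le_mul_iff_right₀ Real.pi_pos, sq_le_sq₀ (norm_nonneg _) (norm_nonneg _)]

lemma discArea_lt_iff {x y : Plane} : discArea x < discArea y ↔ ‖x‖ < ‖y‖ := by
  simpa using discArea_le_iff.not

lemma setOf_discArea_le {b : ℝ} (hb : 0 ≤ b) :
    {x | discArea x ≤ b} = Metric.closedBall 0 (Real.sqrt (b / Real.pi)) := by
  ext x
  rw [Set.mem_ofPred_eq, mem_closedBall_zero_iff, Real.le_sqrt (norm_nonneg _) (by positivity),
    le_div_iff₀ Real.pi_pos, discArea, mul_comm]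

lemma isBounded_setOf_discArea_le (b : ℝ) : Bornology.IsBounded {x | discArea x ≤ b} := by
  have h : {x : Plane | discArea x ≤ b} ⊆ {x | discArea x ≤ max b 0} :=
    Set.ofPred_subset_ofPred.2 fun x hx => hx.trans (le_max_left b 0)
  rw [setOf_discArea_le (le_max_right b 0)] at h
  exact Metric.isBounded_closedBall.subset h

lemma volume_setOf_discArea_le (b : ℝ) :
    volume {x : Plane | discArea x ≤ b} = ENNReal.ofReal b := by
  rcases lt_or_ge b 0 with hb | hb
  · have : {x : Plane | discArea x ≤ b} = ∅ :=
      Set.eq_empty_of_forall_notMem fun x hx => (hb.trans_le (discArea_nonneg x)).not_ge hx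
    simp [this, ENNReal.ofReal_of_nonpos hb.le]
  · rw [setOf_discArea_le hb, EuclideanSpace.volume_closedBall_fin_two,
      ← ENNReal.ofReal_pow (by positivity), ← ENNReal.ofReal_mul (by positivity),
      Real.sq_sqrt (by positivity), div_mul_cancel₀ _ Real.pi_pos.ne']

/-- The disc `discArea ≤ b` has area exactly `b`, so in this coordinate a radial integral carries no
Jacobian. -/
lemma map_discArea : (volume : Measure Plane).map discArea = volume.restrict (Set.Ioi 0) := by
  symm
  refine Measure.ext_of_Ioc _ _ fun a b hab => ?_
  have hpre : discArea ⁻¹' Set.Ioc a b = {x | discArea x ≤ b} \ {x | discArea x ≤ a} := by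
    ext x; simp [and_comm]
  rw [Measure.map_apply measurable_discArea measurableSet_Ioc, hpre,
    measure_sdiff (Set.ofPred_subset_ofPred.2 fun x hx => hx.trans hab.le)
      (measurableSet_le measurable_discArea measurable_const).nullMeasurableSet
      (by simp [volume_setOf_discArea_le]),
    volume_setOf_discArea_le, volume_setOf_discArea_le, Measure.restrict_apply measurableSet_Ioc,
    Set.Ioc_inter_Ioi, Real.volume_Ioc]
  rcases le_total 0 a with ha | ha
  · rw [sup_of_le_left ha, ENNReal.ofReal_sub _ ha]
  · rw [sup_of_le_right ha, ENNReal.ofReal_of_nonpos ha]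
    simp

lemma lintegral_discArea {f : ℝ → ℝ≥0∞} (hf : Measurable f) :
    ∫⁻ x : Plane, f (discArea x) = ∫⁻ v in Set.Ioi 0, f v := by
  rw [← map_discArea, lintegral_map hf measurable_discArea]

/-- `v + ∫_v^∞ (1 - u)`. -/
def hazard (u : ℝ → ℝ≥0∞) (v : ℝ) : ℝ≥0∞ :=
  ENNReal.ofReal v + ∫⁻ y in Set.Ioi v, (1 - u y)

@[fun_prop] lemma measurable_hazard (u : ℝ → ℝ≥0∞) : Measurable (hazard u) := by
  have h : Antitone fun v => ∫⁻ y in Set.Ioi v, (1 - u y) := fun _ _ hab =>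
    lintegral_mono_set (Set.Ioi_subset_Ioi hab)
  exact ENNReal.measurable_ofReal.add h.measurable

/-- Moving `∫₀^v (1 - u)` from one term to the other shows the hazard as a constant plus a primitive
of `u`, which can be differentiated. -/
lemma hazard_eq_ofReal {u : ℝ → ℝ≥0∞} (hu : Measurable u) (hu1 : ∀ v, u v ≤ 1)
    (hΓ : ∫⁻ y in Set.Ioi (0 : ℝ), (1 - u y) ≠ ⊤) {v : ℝ} (hv : 0 ≤ v) :
    hazard u v = ENNReal.ofReal
      ((∫⁻ y in Set.Ioi (0 : ℝ), (1 - u y)).toReal + ∫ y in (0 : ℝ)..v, (u y).toReal) := by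
  have hnn : 0 ≤ ∫ y in (0 : ℝ)..v, (u y).toReal :=
    intervalIntegral.integral_nonneg hv fun _ _ => ENNReal.toReal_nonneg
  have hint : ENNReal.ofReal (∫ y in (0 : ℝ)..v, (u y).toReal) = ∫⁻ y in Set.Ioc 0 v, u y := by
    rw [intervalIntegral.integral_of_le hv, integral_toReal hu.aemeasurable
      (ae_of_all _ fun y => (hu1 y).trans_lt ENNReal.one_lt_top), ENNReal.ofReal_toReal]
    refine ((lintegral_mono fun y => hu1 y).trans_lt ?_).ne
    simp
  have hsplit : ∫⁻ y in Set.Ioi (0 : ℝ), (1 - u y) =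
      (∫⁻ y in Set.Ioc 0 v, (1 - u y)) + ∫⁻ y in Set.Ioi v, (1 - u y) := by
    rw [← lintegral_union measurableSet_Ioi (by
      rw [Set.disjoint_left]; intro y hy hy'; exact hy.2.not_gt hy'), Set.Ioc_union_Ioi_eq_Ioi hv]
  rw [ENNReal.ofReal_add ENNReal.toReal_nonneg hnn, ENNReal.ofReal_toReal hΓ, hint, hsplit, hazard,
    add_right_comm, ← lintegral_add_right _ hu]
  congr 1
  simp_rw [tsub_add_cancel_of_le (hu1 _)]
  simp

/-- If `0 ≤ u ≤ 1`, then `c u(v) exp (-c (v + ∫_v^∞ (1 - u)))` is the density of a measure with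
tail function `exp (-c (a + ∫_a^∞ (1 - u)))`. -/
lemma lintegral_mul_expNeg_hazard {u : ℝ → ℝ≥0∞} (hu : Measurable u) (hu1 : ∀ v, u v ≤ 1)
    (hΓ : ∫⁻ y in Set.Ioi (0 : ℝ), (1 - u y) ≠ ⊤) {c : ℝ≥0} (hc : 0 < c) {a : ℝ} (ha : 0 ≤ a) :
    ∫⁻ v in Set.Ioi a, c * u v * expNeg (c * hazard u v) = expNeg (c * hazard u a) := by
  set g : ℝ → ℝ := fun v => (u v).toReal with hg
  set C : ℝ := (∫⁻ y in Set.Ioi (0 : ℝ), (1 - u y)).toReal with hC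
  set J : ℝ → ℝ := fun v => C + ∫ y in (0 : ℝ)..v, g y with hJ
  set E : ℝ → ℝ := fun v => Real.exp (-(c * J v)) with hE
  have hutop : ∀ v, u v ≠ ⊤ := fun v => ((hu1 v).trans_lt ENNReal.one_lt_top).ne
  have hg0 : ∀ v, 0 ≤ g v := fun v => ENNReal.toReal_nonneg
  have hg1 : ∀ v, g v ≤ 1 := fun v => by
    simpa using ENNReal.toReal_mono ENNReal.one_ne_top (hu1 v)
  have hgm : Measurable g := hu.ennreal_toReal
  have hgloc : LocallyIntegrable g volume := by
    refine LocallyIntegrable.mono (locallyIntegrable_const (1 : ℝ))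
      hgm.aestronglyMeasurable (ae_of_all _ fun v => ?_)
    rw [Real.norm_of_nonneg (hg0 v)]
    simpa using hg1 v
  have hgi : ∀ x y, IntervalIntegrable g volume x y := fun x y =>
    intervalIntegrable_iff.2 ((hgloc.integrableOn_isCompact isCompact_uIcc).mono_set
      Set.uIoc_subset_uIcc)
  have hJsub : ∀ x y, J y - J x = ∫ t in x..y, g t := fun x y => by
    simp only [hJ]
    rw [← intervalIntegral.integral_add_adjacent_intervals (hgi 0 x) (hgi x y)]
    ring
  have hJ0 : ∀ v, 0 ≤ v → 0 ≤ J v := fun v hv =>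
    add_nonneg ENNReal.toReal_nonneg (intervalIntegral.integral_nonneg hv fun _ _ => hg0 _)
  have hhaz : ∀ v, 0 ≤ v → expNeg (c * hazard u v) = ENNReal.ofReal (E v) := fun v hv => by
    rw [hazard_eq_ofReal hu hu1 hΓ hv, ← ENNReal.ofReal_coe_nnreal,
      ← ENNReal.ofReal_mul c.coe_nonneg, expNeg_ofReal (mul_nonneg c.coe_nonneg (hJ0 v hv))]
  -- As `u` is only measurable, Lebesgue differentiation gives the derivative almost everywhere. The
  -- Lipschitz bound `hlip` then supplies the absolute continuity that the fundamental theorem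
  -- needs.
  have hderiv : ∀ᵐ v, HasDerivAt E (-(c * g v * E v)) v := by
    filter_upwards [LocallyIntegrable.ae_hasDerivAt_integral hgloc] with v hv
    have := ((((hv 0).const_add C).const_mul (c : ℝ)).neg).exp
    convert! this using 1
    simp [hE, hJ]; ring
  have hlip : LipschitzOnWith c E (Set.Ici 0) := by
    refine LipschitzOnWith.of_dist_le_mul fun x hx y hy => ?_
    wlog hxy : x ≤ y generalizing x y
    · rw [dist_comm, dist_comm x]; exact this y hy x hx (le_of_not_ge hxy)
    have h1 : 0 ≤ J y - J x := by
      rw [hJsub]; exact intervalIntegral.integral_nonneg hxy fun _ _ => hg0 _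
    have h2 : J y - J x ≤ y - x := by
      rw [hJsub]
      calc ∫ t in x..y, g t ≤ ∫ t in x..y, (1 : ℝ) :=
            intervalIntegral.integral_mono_on hxy (hgi x y) (by simp) fun t _ => hg1 t
        _ = y - x := by simp
    have h3 : E y ≤ E x := Real.exp_le_exp.2 (by nlinarith [c.coe_nonneg])
    have h4 : E x ≤ 1 := Real.exp_le_one_iff.2 (by nlinarith [c.coe_nonneg, hJ0 x hx])
    have h5 : E x - E y ≤ c * (J y - J x) := by
      have h6 : E y = E x * Real.exp (-(c * (J y - J x))) := by
        rw [hE, ← Real.exp_add]; ring_nf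
      have h7 := Real.add_one_le_exp (-(c * (J y - J x)))
      have h8 : 0 ≤ E x := (Real.exp_pos _).le
      have h9 : 0 ≤ c * (J y - J x) := mul_nonneg c.coe_nonneg h1
      nlinarith
    rw [Real.dist_eq, Real.dist_eq, abs_of_nonneg (by linarith), abs_of_nonpos (by linarith)]
    nlinarith [c.coe_nonneg]
  have hFTC : ∀ b, a ≤ b → ∫⁻ v in Set.Ioc a b, c * u v * expNeg (c * hazard u v) =
      ENNReal.ofReal (E a - E b) := fun b hab => by
    have hsub : Set.uIcc a b ⊆ Set.Ici 0 := by
      rw [Set.uIcc_of_le hab]; exact fun t ht => ha.trans ht.1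
    have hAC := (hlip.mono hsub).absolutelyContinuousOnInterval
    have h1 := hAC.integral_deriv_eq_sub
    have h2 : ∀ᵐ v, deriv E v = -(c * g v * E v) := hderiv.mono fun v hv => hv.deriv
    have hii := hAC.intervalIntegrable_deriv.neg
    have h3 : ∫ v in a..b, -deriv E v = E a - E b := by
      rw [intervalIntegral.integral_neg, h1]; ring
    rw [← h3, intervalIntegral.integral_of_le hab]
    change _ = ENNReal.ofReal (∫ v in Set.Ioc a b, (-deriv E) v)
    rw [ofReal_integral_eq_lintegral_ofReal hii.1]
    · refine setLIntegral_congr_fun_ae measurableSet_Ioc ?_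
      filter_upwards [h2] with v hv hvab
      rw [hhaz v (ha.trans hvab.1.le)]
      simp only [Pi.neg_apply]
      rw [hv, neg_neg, ENNReal.ofReal_mul (by have := hg0 v; positivity),
        ENNReal.ofReal_mul c.coe_nonneg, ENNReal.ofReal_toReal (hutop v),
        ENNReal.ofReal_coe_nnreal]
    · refine ae_restrict_of_ae ?_
      filter_upwards [h2] with v hv
      simp only [Pi.neg_apply, Pi.zero_apply]
      rw [hv, neg_neg]
      have := hg0 v
      positivity
  -- `J v ≥ v`, because the hazard is `v` plus a nonnegative term.
  have hE0 : Tendsto E atTop (𝓝 0) := by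
    refine Real.tendsto_exp_neg_atTop_nhds_zero.comp ?_
    refine Tendsto.const_mul_atTop (by exact_mod_cast hc) ?_
    refine tendsto_atTop_mono' _ ?_ tendsto_id
    filter_upwards [eventually_ge_atTop 0] with v hv
    have h1 : ENNReal.ofReal v ≤ ENNReal.ofReal (J v) := by
      rw [← hazard_eq_ofReal hu hu1 hΓ hv]; exact le_self_add
    exact (ENNReal.ofReal_le_ofReal_iff (hJ0 v hv)).1 h1
  have hmeas : AEMeasurable (fun v => c * u v * expNeg (c * hazard u v))
      (volume.restrict (Set.Ioi a)) := by
    have hEm : AEMeasurable (fun v => ENNReal.ofReal (E v)) (volume.restrict (Set.Ioi a)) := by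
      have h1 : ContinuousOn E (Set.Ioi a) :=
        hlip.continuousOn.mono fun t (ht : a < t) => ha.trans ht.le
      exact (h1.aemeasurable measurableSet_Ioi).ennreal_ofReal
    refine (((hu.const_mul (c : ℝ≥0∞)).aemeasurable).mul hEm).congr ?_
    filter_upwards [ae_restrict_mem measurableSet_Ioi] with v hv
    simp only [Pi.mul_apply]
    rw [hhaz v (ha.trans (le_of_lt hv))]
  refine ((aecover_Iic (μ := volume.restrict (Set.Ioi a)) tendsto_id).lintegral_eq_of_tendsto _
    hmeas ?_)
  rw [hhaz a ha]
  have h1 : Tendsto (fun b => ENNReal.ofReal (E a - E b)) atTop (𝓝 (ENNReal.ofReal (E a - 0))) :=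
    ENNReal.tendsto_ofReal (hE0.const_sub _)
  rw [sub_zero] at h1
  refine h1.congr' ?_
  filter_upwards [eventually_ge_atTop a] with b hb
  rw [← hFTC b hb, Measure.restrict_restrict measurableSet_Iic, Set.inter_comm,
    Set.Ioi_inter_Iic]
  rfl

/-! ### Laplace functional of the Poisson process -/

lemma expNeg_mul_natCast (y : ℝ≥0∞) (n : ℕ) : expNeg (y * n) = expNeg y ^ n := by
  induction n with
  | zero => simp
  | succ n ih => rw [Nat.cast_succ, mul_add, mul_one, expNeg_add, ih, pow_succ]

lemma lintegral_expNeg_poissonMeasure (r : ℝ≥0) (y : ℝ≥0∞) :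
    ∫⁻ n, expNeg (y * n) ∂poissonMeasure r = expNeg (r * (1 - expNeg y)) := by
  obtain ⟨p, hp⟩ : ∃ p : ℝ≥0, expNeg y = p := ⟨_, (ENNReal.coe_toNNReal (expNeg_ne_top y)).symm⟩
  have hp1 : (p : ℝ) ≤ 1 := by
    have := expNeg_le_one y
    rw [hp] at this; exact_mod_cast this
  -- The series for `𝔼 p^N` is the total mass of the Poisson law of mean `r p`, times `e^{-r(1-p)}`.
  have hs := (hasSum_one_poissonMeasure (r * p)).mul_left (Real.exp (-(r * (1 - p))))
  have hterm : ∀ n : ℕ, Real.exp (-(r * (1 - p))) * (Real.exp (-(r * p : ℝ≥0)) * (r * p : ℝ≥0) ^ n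
      / n.factorial) = Real.exp (-r) * r ^ n / n.factorial * p ^ n := fun n => by
    have : Real.exp (-r : ℝ) = Real.exp (-(r * (1 - p))) * Real.exp (-(r * p : ℝ≥0)) := by
      rw [← Real.exp_add]; push_cast; ring_nf
    rw [this]; push_cast; ring
  simp_rw [hterm, mul_one] at hs
  simp_rw [expNeg_mul_natCast, hp]
  rw [poissonMeasure, lintegral_sum_measure]
  simp_rw [lintegral_smul_measure, lintegral_dirac]
  have h1 : ∀ n : ℕ, ENNReal.ofReal (Real.exp (-r) * r ^ n / n.factorial) • (p : ℝ≥0∞) ^ n =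
      ENNReal.ofReal (Real.exp (-r) * r ^ n / n.factorial * p ^ n) := fun n => by
    rw [ENNReal.ofReal_mul (by positivity), ENNReal.ofReal_pow p.coe_nonneg,
      ENNReal.ofReal_coe_nnreal, smul_eq_mul]
  simp_rw [h1]
  rw [← ENNReal.ofReal_tsum_of_nonneg (fun n => by positivity) hs.summable, hs.tsum_eq,
    ← expNeg_ofReal (mul_nonneg r.coe_nonneg (by linarith)), ENNReal.ofReal_mul r.coe_nonneg,
    ENNReal.ofReal_coe_nnreal, ENNReal.ofReal_sub _ p.coe_nonneg, ENNReal.ofReal_coe_nnreal,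
    ENNReal.ofReal_one]

lemma lintegral_countingMeasure (x : ℕ → Plane) {g : Plane → ℝ≥0∞} :
    ∫⁻ y, g y ∂countingMeasure x = ∑' n, g (x n) := by
  rw [countingMeasure, lintegral_sum_measure]
  simp_rw [lintegral_dirac]

lemma countingMeasure_apply (x : ℕ → Plane) {B : Set Plane} (hB : MeasurableSet B) :
    countingMeasure x B = ∑' n, B.indicator 1 (x n) := by
  rw [← lintegral_countingMeasure, lintegral_indicator_one hB]

namespace IsPoissonProcess

variable {Ω : Type*} [MeasurableSpace Ω] {P : Measure Ω} {lam : ℝ≥0} {X : ℕ → Ω → Plane}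

lemma measurable_count (h : IsPoissonProcess P lam X) {B : Set Plane} (hB : MeasurableSet B) :
    Measurable fun ω => countingMeasure (fun n => X n ω) B := by
  simp_rw [countingMeasure_apply _ hB]
  exact Measurable.tsum fun n => (measurable_one.indicator hB).comp (h.measurable n)

lemma measurable_tsum (h : IsPoissonProcess P lam X) {g : Plane → ℝ≥0∞} (hg : Measurable g) :
    Measurable fun ω => ∑' n, g (X n ω) :=
  Measurable.tsum fun n => hg.comp (h.measurable n)

lemma lintegral_expNeg_count (h : IsPoissonProcess P lam X) {B : Set Plane} (hB : MeasurableSet B)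
    (hb : Bornology.IsBounded B) (y : ℝ≥0∞) :
    ∫⁻ ω, expNeg (y * countingMeasure (fun n => X n ω) B) ∂P =
      expNeg (lam * ((1 - expNeg y) * volume B)) := by
  have h1 := lintegral_map (μ := P) (f := fun c => expNeg (y * c)) (by fun_prop)
    (h.measurable_count hB)
  rw [← h1, (h.hasLaw_count B hB hb).map_eq, lintegral_map (by fun_prop) .of_discrete,
    lintegral_expNeg_poissonMeasure, ENNReal.coe_mul, ENNReal.coe_toNNReal hb.measure_lt_top.ne]
  ring_nf

/-- The counts on the disjoint level sets are independent, so the expectation is a product of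
Poisson transforms. The value `0` is dropped: its level set is unbounded, and it contributes
nothing. -/
lemma lintegral_expNeg_simpleFunc (h : IsPoissonProcess P lam X) (g : SimpleFunc Plane ℝ≥0∞)
    (hb : Bornology.IsBounded (Function.support g)) :
    ∫⁻ ω, expNeg (∑' n, g (X n ω)) ∂P = expNeg (lam * ∫⁻ x, (1 - expNeg (g x))) := by
  classical
  set s : Finset ℝ≥0∞ := g.range \ {0} with hs
  have hbB : ∀ y ∈ s, Bornology.IsBounded (g ⁻¹' {y}) := fun y hy => by
    refine hb.subset fun x hx => ?_
    have hx : g x = y := hx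
    have : y ≠ 0 := by simpa using (Finset.mem_sdiff.1 hy).2
    rw [Function.mem_support, hx]
    exact this
  have hsum : ∀ μ : Measure Plane, ∫⁻ x, g x ∂μ = ∑ y ∈ s, y * μ (g ⁻¹' {y}) := fun μ => by
    rw [SimpleFunc.lintegral_eq_lintegral, SimpleFunc.lintegral_eq_of_subset' g le_rfl]
  let e := s.equivFin
  have hind : iIndepFun (fun i ω => countingMeasure (fun n => X n ω) (g ⁻¹' {(e.symm i : ℝ≥0∞)}))
      P := by
    refine h.indep_count _ _ (fun i => g.measurableSet_fiber _) (fun i => hbB _ (e.symm i).2) ?_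
    intro i j hij
    refine Set.disjoint_left.2 fun x hx hx' => hij ?_
    have h1 : g x = e.symm i := hx
    have h2 : g x = e.symm j := hx'
    exact e.symm.injective (Subtype.ext (h1.symm.trans h2))
  have hind' : iIndepFun (fun i ω => expNeg ((e.symm i : ℝ≥0∞) *
      countingMeasure (fun n => X n ω) (g ⁻¹' {(e.symm i : ℝ≥0∞)}))) P :=
    hind.comp (fun i c => expNeg ((e.symm i : ℝ≥0∞) * c)) fun i => by fun_prop
  have hL : ∀ ω, expNeg (∑' n, g (X n ω)) = ∏ i ∈ Finset.univ, expNeg ((e.symm i : ℝ≥0∞) *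
      countingMeasure (fun n => X n ω) (g ⁻¹' {(e.symm i : ℝ≥0∞)})) := fun ω => by
    rw [← lintegral_countingMeasure, hsum, expNeg_sum, ← Finset.prod_coe_sort,
      ← e.symm.prod_comp]
  have hR : ∫⁻ x, (1 - expNeg (g x)) = ∑ y ∈ s, (1 - expNeg y) * volume (g ⁻¹' {y}) := by
    have h1 : ∫⁻ x, (1 - expNeg (g x)) = (g.map fun y => 1 - expNeg y).lintegral volume := by
      rw [← SimpleFunc.lintegral_eq_lintegral]; rfl
    rw [h1, SimpleFunc.map_lintegral]
    refine (Finset.sum_subset Finset.sdiff_subset fun y hy hys => ?_).symm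
    have : y = 0 := by simpa [hy, hs] using hys
    simp [this]
  simp_rw [hL]
  rw [lintegral_prod_eq_prod_lintegral_of_indepFun _ _ hind' fun i => ?_]
  · rw [hR, Finset.mul_sum, expNeg_sum, ← Finset.prod_coe_sort s, ← e.symm.prod_comp]
    refine Finset.prod_congr rfl fun i _ => ?_
    exact h.lintegral_expNeg_count (g.measurableSet_fiber _) (hbB _ (e.symm i).2) _
  · have := h.measurable_count (g.measurableSet_fiber (e.symm i : ℝ≥0∞))
    fun_prop

/-- Laplace functional of the Poisson process. -/
lemma lintegral_expNeg_tsum [IsProbabilityMeasure P] (h : IsPoissonProcess P lam X)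
    {g : Plane → ℝ≥0∞} (hg : Measurable g) :
    ∫⁻ ω, expNeg (∑' n, g (X n ω)) ∂P = expNeg (lam * ∫⁻ x, (1 - expNeg (g x))) := by
  -- The cut-off to balls gives the approximants bounded support, since the law of the counts is
  -- prescribed on bounded sets only.
  set G : ℕ → SimpleFunc Plane ℝ≥0∞ := fun k =>
    (SimpleFunc.eapprox g k).restrict (Metric.closedBall 0 k) with hG
  have hGapp : ∀ k x, G k x = (Metric.closedBall 0 (k : ℝ)).indicator (SimpleFunc.eapprox g k) x :=
    fun k x => by
      rw [hG, SimpleFunc.coe_restrict _ Metric.isClosed_closedBall.measurableSet]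
  have hmono : ∀ x, Monotone fun k => G k x := fun x i j hij => by
    simp only [hGapp]
    refine (Set.indicator_le_indicator (SimpleFunc.monotone_eapprox g hij x)).trans ?_
    exact Set.indicator_le_indicator_of_subset
      (Metric.closedBall_subset_closedBall (by exact_mod_cast hij)) (fun _ => zero_le) x
  have hlim : ∀ x, Tendsto (fun k => G k x) atTop (𝓝 (g x)) := fun x => by
    refine (SimpleFunc.tendsto_eapprox hg x).congr' ?_
    obtain ⟨N, hN⟩ := exists_nat_ge ‖x‖
    filter_upwards [eventually_ge_atTop N] with k hk
    rw [hGapp, Set.indicator_of_mem]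
    rw [mem_closedBall_zero_iff]
    exact hN.trans (by exact_mod_cast hk)
  have hsupp : ∀ k, Bornology.IsBounded (Function.support (G k)) := fun k => by
    refine Metric.isBounded_closedBall (x := (0 : Plane)) (r := k) |>.subset fun x hx => ?_
    by_contra hxk
    exact hx (by rw [hGapp, Set.indicator_of_notMem hxk])
  have hL : Tendsto (fun k => ∫⁻ ω, expNeg (∑' n, G k (X n ω)) ∂P) atTop
      (𝓝 (∫⁻ ω, expNeg (∑' n, g (X n ω)) ∂P)) := by
    refine tendsto_lintegral_of_dominated_convergence (fun _ => 1) (fun k => ?_)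
      (fun k => ae_of_all _ fun ω => expNeg_le_one _) (by simp) (ae_of_all _ fun ω => ?_)
    · exact measurable_expNeg.comp (h.measurable_tsum (G k).measurable)
    · refine (continuous_expNeg.tendsto _).comp ?_
      simp_rw [← lintegral_countingMeasure]
      exact lintegral_tendsto_of_tendsto_of_monotone (fun k => (G k).measurable.aemeasurable)
        (ae_of_all _ hmono) (ae_of_all _ hlim)
  have hR : Tendsto (fun k => expNeg (lam * ∫⁻ x, (1 - expNeg (G k x)))) atTop
      (𝓝 (expNeg (lam * ∫⁻ x, (1 - expNeg (g x))))) := by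
    refine (continuous_expNeg.tendsto _).comp (ENNReal.Tendsto.const_mul ?_ (Or.inr (by simp)))
    refine lintegral_tendsto_of_tendsto_of_monotone (fun k => ?_) (ae_of_all _ fun x i j hij => ?_)
      (ae_of_all _ fun x => ?_)
    · have := (G k).measurable
      fun_prop
    · exact tsub_le_tsub_left (expNeg_antitone (hmono x hij)) _
    · exact ENNReal.Tendsto.sub tendsto_const_nhds
        ((continuous_expNeg.tendsto _).comp (hlim x)) (Or.inl (by simp))
  refine tendsto_nhds_unique hL (hR.congr fun k => ?_)
  rw [h.lintegral_expNeg_simpleFunc _ (hsupp k)]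

/-! ### Local finiteness and simplicity in the radial direction -/

lemma ae_count_lt_top (h : IsPoissonProcess P lam X) {B : Set Plane} (hB : MeasurableSet B)
    (hb : Bornology.IsBounded B) : ∀ᵐ ω ∂P, countingMeasure (fun n => X n ω) B < ⊤ := by
  have hms : MeasurableSet {c : ℝ≥0∞ | ¬ c < ⊤} := (measurableSet_Iio (a := (⊤ : ℝ≥0∞))).compl
  rw [ae_iff, (h.hasLaw_count B hB hb).measure_eq hms, Measure.map_apply .of_discrete hms]
  convert! measure_empty (μ := poissonMeasure (lam * (volume B).toNNReal))
  ext n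
  simp

lemma measure_two_le_count (h : IsPoissonProcess P lam X) {B : Set Plane} (hB : MeasurableSet B)
    (hb : Bornology.IsBounded B) :
    P {ω | 2 ≤ countingMeasure (fun n => X n ω) B} ≤ (lam * volume B) ^ 2 := by
  set r : ℝ≥0 := lam * (volume B).toNNReal with hr
  have hms : MeasurableSet {c : ℝ≥0∞ | 2 ≤ c} := measurableSet_Ici
  rw [(h.hasLaw_count B hB hb).measure_eq hms, Measure.map_apply .of_discrete hms]
  have h1 : (Nat.cast : ℕ → ℝ≥0∞) ⁻¹' {c | 2 ≤ c} = ({0, 1} : Set ℕ)ᶜ := by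
    ext n
    simp only [Set.mem_preimage, Set.mem_ofPred_eq, Set.mem_compl_iff, Set.mem_insert_iff,
      Set.mem_singleton_iff]
    rw [← Nat.cast_ofNat, Nat.cast_le]
    omega
  have h2 : poissonMeasure r {0, 1} = ENNReal.ofReal (Real.exp (-r) * (1 + r)) := by
    rw [Set.insert_eq, measure_union (by simp) (measurableSet_singleton _),
      poissonMeasure_singleton, poissonMeasure_singleton, ← ENNReal.ofReal_add (by positivity)
      (by positivity)]
    congr 1
    simp; ring
  have h3 : (lam * volume B : ℝ≥0∞) ^ 2 = ENNReal.ofReal (r ^ 2) := by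
    rw [ENNReal.ofReal_pow r.coe_nonneg, ENNReal.ofReal_coe_nnreal, hr, ENNReal.coe_mul,
      ENNReal.coe_toNNReal hb.measure_lt_top.ne]
  rw [h1, prob_compl_eq_one_sub (by measurability), h2, h3, tsub_le_iff_right, ← ENNReal.ofReal_add
    (by positivity) (by positivity), ← ENNReal.ofReal_one]
  refine ENNReal.ofReal_le_ofReal ?_
  -- From `e^{-r} ≥ 1 - r` one gets `e^{-r} (1 + r) ≥ 1 - r²`.
  nlinarith [Real.add_one_le_exp (-(r : ℝ)), r.coe_nonneg]

lemma ae_finite_discArea_le (h : IsPoissonProcess P lam X) (b : ℝ) :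
    ∀ᵐ ω ∂P, {n | discArea (X n ω) ≤ b}.Finite := by
  have hB : MeasurableSet {x : Plane | discArea x ≤ b} :=
    measurableSet_le measurable_discArea measurable_const
  filter_upwards [h.ae_count_lt_top hB (isBounded_setOf_discArea_le b)] with ω hω
  rw [countingMeasure_apply _ hB] at hω
  refine (ENNReal.finite_const_le_of_tsum_ne_top hω.ne one_ne_zero).subset fun n hn => ?_
  have hn : X n ω ∈ {x : Plane | discArea x ≤ b} := hn
  rw [Set.mem_ofPred_eq, Set.indicator_of_mem hn]
  rfl

/-- Cut the disc of area `N` into `N (K + 1)` annuli of area `1 / (K + 1)`. Two equidistant points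
share an annulus, which for a given annulus has probability at most `(λ / (K + 1))²`. The union
bound is `N λ² / (K + 1)`, and `K` is arbitrary. -/
lemma ae_discArea_ne_of_lt (h : IsPoissonProcess P lam X) (N : ℕ) :
    ∀ᵐ ω ∂P, ∀ n m, n ≠ m → discArea (X n ω) < N → discArea (X n ω) ≠ discArea (X m ω) := by
  rw [ae_iff]
  set A := {ω | ¬ ∀ n m, n ≠ m → discArea (X n ω) < N → discArea (X n ω) ≠ discArea (X m ω)}
  have key : ∀ K : ℕ, P A ≤ N * lam ^ 2 * ((K + 1 : ℕ) : ℝ≥0∞)⁻¹ := fun K => by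
    have hK : (0 : ℝ) < (K + 1 : ℕ) := by positivity
    set B : ℕ → Set Plane := fun i => discArea ⁻¹'
      Set.Ico (i / (K + 1 : ℕ) : ℝ) ((i + 1) / (K + 1 : ℕ)) with hBdef
    have hB : ∀ i, MeasurableSet (B i) := fun i => measurable_discArea measurableSet_Ico
    have hb : ∀ i, Bornology.IsBounded (B i) := fun i =>
      (isBounded_setOf_discArea_le ((i + 1) / (K + 1 : ℕ))).subset fun x hx => hx.2.le
    have hvol : ∀ i, volume (B i) ≤ ((K + 1 : ℕ) : ℝ≥0∞)⁻¹ := fun i => by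
      rw [hBdef, ← Measure.map_apply measurable_discArea measurableSet_Ico, map_discArea]
      refine (Measure.restrict_apply_le _ _).trans ?_
      rw [Real.volume_Ico, ← sub_div, add_sub_cancel_left, ENNReal.ofReal_div_of_pos hK,
        ENNReal.ofReal_one, ENNReal.ofReal_natCast, one_div]
    have hsub : A ⊆ ⋃ i ∈ Finset.range (N * (K + 1)),
        {ω | 2 ≤ countingMeasure (fun n => X n ω) (B i)} := fun ω hω => by
      have hω : ¬ ∀ n m, n ≠ m → discArea (X n ω) < N → discArea (X n ω) ≠ discArea (X m ω) := hω
      push Not at hω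
      obtain ⟨n, m, hnm, hlt, heq⟩ := hω
      have hpos : 0 ≤ discArea (X n ω) * (K + 1 : ℕ) := mul_nonneg (discArea_nonneg _) hK.le
      set i := ⌊discArea (X n ω) * (K + 1 : ℕ)⌋₊
      have hn : X n ω ∈ B i :=
        ⟨(div_le_iff₀ hK).2 (Nat.floor_le hpos), (lt_div_iff₀ hK).2 (Nat.lt_floor_add_one _)⟩
      have hm : X m ω ∈ B i := by
        rw [hBdef, Set.mem_preimage, ← heq]; exact hn
      refine Set.mem_biUnion (x := i) ?_ ?_
      · refine Finset.mem_coe.2 (Finset.mem_range.2 ((Nat.floor_lt hpos).2 ?_))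
        rw [Nat.cast_mul]
        exact mul_lt_mul_of_pos_right hlt hK
      · rw [Set.mem_ofPred_eq, countingMeasure_apply _ (hB i)]
        refine le_trans ?_ (ENNReal.sum_le_tsum {n, m})
        rw [Finset.sum_pair hnm, Set.indicator_of_mem hn, Set.indicator_of_mem hm]
        norm_num
    calc P A ≤ ∑ i ∈ Finset.range (N * (K + 1)),
          P {ω | 2 ≤ countingMeasure (fun n => X n ω) (B i)} :=
          (measure_mono hsub).trans (measure_biUnion_finset_le _ _)
      _ ≤ ∑ i ∈ Finset.range (N * (K + 1)), (lam * ((K + 1 : ℕ) : ℝ≥0∞)⁻¹) ^ 2 :=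
          Finset.sum_le_sum fun i _ => (h.measure_two_le_count (hB i) (hb i)).trans (by
            gcongr; exact hvol i)
      _ = N * lam ^ 2 * (((K + 1 : ℕ) : ℝ≥0∞)⁻¹ * (((K + 1 : ℕ) : ℝ≥0∞) *
            ((K + 1 : ℕ) : ℝ≥0∞)⁻¹)) := by
          rw [Finset.sum_const, Finset.card_range, nsmul_eq_mul, Nat.cast_mul]; ring
      _ = _ := by
          rw [ENNReal.mul_inv_cancel (by simp) (ENNReal.natCast_ne_top _), mul_one]
  have hlim : Tendsto (fun K : ℕ => N * lam ^ 2 * ((K + 1 : ℕ) : ℝ≥0∞)⁻¹) atTop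
      (𝓝 (N * lam ^ 2 * 0)) :=
    ENNReal.Tendsto.const_mul (ENNReal.tendsto_inv_nat_nhds_zero.comp (tendsto_add_atTop_nat 1))
      (Or.inr (by finiteness))
  rw [mul_zero] at hlim
  exact le_antisymm (ge_of_tendsto' hlim key) zero_le

/-- Almost surely, the points have distinct distances to the origin. -/
lemma ae_injective_discArea (h : IsPoissonProcess P lam X) :
    ∀ᵐ ω ∂P, Function.Injective fun n => discArea (X n ω) := by
  filter_upwards [ae_all_iff.2 h.ae_discArea_ne_of_lt] with ω hω n m hnm
  by_contra hne
  obtain ⟨N, hN⟩ := exists_nat_gt (discArea (X n ω))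
  exact hω N n m hne hN hnm

/-- Almost surely, some point is nearest to the origin. -/
lemma ae_exists_nearest (h : IsPoissonProcess P lam X) :
    ∀ᵐ ω ∂P, ∃ n, ∀ m, ‖X n ω‖ ≤ ‖X m ω‖ := by
  filter_upwards [ae_all_iff.2 fun N : ℕ => h.ae_finite_discArea_le N] with ω hω
  obtain ⟨N, hN⟩ := exists_nat_ge (discArea (X 0 ω))
  obtain ⟨n, hn, hmin⟩ := Set.exists_min_image _ (fun n => discArea (X n ω)) (hω N) ⟨0, hN⟩
  refine ⟨n, fun m => discArea_le_iff.1 ?_⟩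
  by_cases hm : discArea (X m ω) ≤ N
  · exact hmin m hm
  · exact (show discArea (X n ω) ≤ N from hn).trans (not_le.1 hm).le

end IsPoissonProcess

/-! ### The serving base station -/

lemma servingIndex_spec {x : ℕ → Plane} (hx : ∃ n, ∀ m, ‖x n‖ ≤ ‖x m‖) (m : ℕ) :
    ‖x (servingIndex x)‖ ≤ ‖x m‖ :=
  Nat.sInf_mem (s := {n | ∀ m, ‖x n‖ ≤ ‖x m‖}) hx m

/-- The second alternative is the default `sInf ∅ = 0`. The right-hand side exhibits the fibres of
`servingIndex` as countable combinations of measurable sets. -/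
lemma sInf_setOf_eq_iff (p : ℕ → Prop) (k : ℕ) :
    sInf {n | p n} = k ↔ (p k ∧ ∀ j < k, ¬ p j) ∨ (k = 0 ∧ ∀ j, ¬ p j) := by
  classical
  by_cases h : ∃ n, p n
  · rw [Nat.sInf_def (s := {n | p n}) h, Nat.find_eq_iff]
    simp only [Set.mem_ofPred_eq]
    obtain ⟨n, hn⟩ := h
    constructor
    · exact Or.inl
    · rintro (h | h)
      · exact h
      · exact absurd hn (h.2 n)
  · push Not at h
    have : {n | p n} = ∅ := Set.eq_empty_of_forall_notMem h
    rw [this, Nat.sInf_empty]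
    constructor
    · rintro rfl; exact Or.inr ⟨rfl, h⟩
    · rintro (h' | h')
      · exact absurd h'.1 (h k)
      · exact h'.1.symm

@[fun_prop] lemma measurable_servingIndex : Measurable servingIndex := by
  refine measurable_to_countable' fun k => ?_
  have hp : ∀ n, MeasurableSet {x : ℕ → Plane | ∀ m, ‖x n‖ ≤ ‖x m‖} := fun n => by
    rw [Set.ofPred_forall]
    exact MeasurableSet.iInter fun m => measurableSet_le (by fun_prop) (by fun_prop)
  have hpre : servingIndex ⁻¹' {k} = {x : ℕ → Plane |
      ((∀ m, ‖x k‖ ≤ ‖x m‖) ∧ ∀ j < k, ¬ ∀ m, ‖x j‖ ≤ ‖x m‖) ∨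
        (k = 0 ∧ ∀ j, ¬ ∀ m, ‖x j‖ ≤ ‖x m‖)} := by
    ext x
    exact sInf_setOf_eq_iff (fun n => ∀ m, ‖x n‖ ≤ ‖x m‖) k
  rw [hpre]
  simp only [Set.ofPred_or, Set.ofPred_and, Set.ofPred_forall, ← Set.compl_ofPred]
  simp only [Set.ofPred_forall] at hp
  exact ((hp k).inter (.iInter fun j => .iInter fun _ => (hp j).compl)).union
    ((MeasurableSet.const _).inter (.iInter fun j => (hp j).compl))

/-- Area of the disc whose radius is the distance to the serving base station. -/
def servingArea (x : ℕ → Plane) : ℝ := discArea (x (servingIndex x))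

lemma measurable_apply_index {α β : Type*} [MeasurableSpace α] [MeasurableSpace β]
    {f : ℕ → α → β} (hf : ∀ n, Measurable (f n)) {k : α → ℕ} (hk : Measurable k) :
    Measurable fun a => f (k a) a :=
  (measurable_from_prod_countable_right (f := fun p : ℕ × α => f p.1 p.2) hf).comp
    (hk.prodMk measurable_id)

@[fun_prop] lemma measurable_servingArea : Measurable servingArea :=
  measurable_apply_index (f := fun n (x : ℕ → Plane) => discArea (x n)) (fun n => by fun_prop)
    measurable_servingIndex

/-! ### Weighted law of the disc area up to the nearest point -/

namespace IsPoissonProcess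

variable {Ω : Type*} [MeasurableSpace Ω] {P : Measure Ω} {lam : ℝ≥0} {X : ℕ → Ω → Plane}

lemma measurable_config (h : IsPoissonProcess P lam X) : Measurable fun ω n => X n ω :=
  measurable_pi_lambda _ h.measurable

/-- Giving the test function the value `⊤` on discs of area at most `a` kills every configuration
with a point there. A single Laplace functional thus encodes both the event that this disc is empty
and the weights `u` of the points. For negative `a` the event is almost sure, hence `max a 0`. -/
lemma setLIntegral_expNeg_tsum_negLog [IsProbabilityMeasure P] (h : IsPoissonProcess P lam X)
    {u : ℝ → ℝ≥0∞} (hu : Measurable u) (hu0 : ∀ v, u v ≠ 0) (hu1 : ∀ v, u v ≤ 1) (a : ℝ) :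
    ∫⁻ ω in {ω | a < servingArea fun n => X n ω},
        expNeg (∑' n, negLog (u (discArea (X n ω)))) ∂P =
      expNeg (lam * hazard u (max a 0)) := by
  set g : ℝ → ℝ≥0∞ := fun v => if v ≤ a then ⊤ else negLog (u v) with hg
  have hgm : Measurable g := Measurable.ite measurableSet_Iic (by fun_prop) (by fun_prop)
  have hset : MeasurableSet {ω | a < servingArea fun n => X n ω} :=
    measurableSet_lt measurable_const (measurable_servingArea.comp h.measurable_config)
  have h1 : ∫⁻ ω in {ω | a < servingArea fun n => X n ω},
      expNeg (∑' n, negLog (u (discArea (X n ω)))) ∂P =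
        ∫⁻ ω, expNeg (∑' n, g (discArea (X n ω))) ∂P := by
    rw [← lintegral_indicator hset]
    refine lintegral_congr_ae ?_
    filter_upwards [h.ae_exists_nearest] with ω hω
    by_cases hlt : a < servingArea fun n => X n ω
    · rw [Set.indicator_of_mem (show ω ∈ {ω | a < servingArea fun n => X n ω} from hlt)]
      congr 2
      ext n
      have : a < discArea (X n ω) :=
        lt_of_lt_of_le hlt (discArea_le_iff.2 (servingIndex_spec hω n))
      rw [hg]
      simp only [if_neg this.not_ge]
    · rw [Set.indicator_of_notMem (show ω ∉ {ω | a < servingArea fun n => X n ω} from hlt)]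
      have h2 : g (discArea (X (servingIndex fun n => X n ω) ω)) = ⊤ := if_pos (not_lt.1 hlt)
      have h3 : ∑' n, g (discArea (X n ω)) = ⊤ := ENNReal.tsum_eq_top_of_eq_top ⟨_, h2⟩
      rw [h3, expNeg_top]
  rw [h1, h.lintegral_expNeg_tsum (g := fun x => g (discArea x)) (by fun_prop),
    lintegral_discArea (f := fun v => 1 - expNeg (g v)) (by fun_prop)]
  congr 2
  rw [hazard, ← Set.Ioc_union_Ioi_eq_Ioi (le_max_right a 0), lintegral_union measurableSet_Ioi
    (by rw [Set.disjoint_left]; exact fun y hy hy' => hy.2.not_gt hy')]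
  congr 1
  · rw [setLIntegral_congr_fun (g := fun _ => 1) measurableSet_Ioc]
    · simp
    · intro v hv
      have : v ≤ a := by
        rcases le_max_iff.1 hv.2 with h | h
        · exact h
        · exact absurd hv.1 h.not_gt
      simp [hg, this]
  · refine setLIntegral_congr_fun measurableSet_Ioi fun v hv => ?_
    have : a < v := (le_max_left _ _).trans_lt hv
    simp only [hg, if_neg this.not_ge]
    rw [expNeg_negLog (hu0 v) (hu1 v)]

/-- The law of the area of the disc up to the nearest point, on weighting each point by `u`. -/
lemma lintegral_mul_expNeg_tsum_negLog [IsProbabilityMeasure P] (h : IsPoissonProcess P lam X)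
    (hlam : 0 < lam) {u : ℝ → ℝ≥0∞} (hu : Measurable u) (hu0 : ∀ v, u v ≠ 0) (hu1 : ∀ v, u v ≤ 1)
    (hΓ : ∫⁻ y in Set.Ioi (0 : ℝ), (1 - u y) ≠ ⊤)
    {F : ℝ → ℝ≥0∞} (hF : Measurable F) :
    ∫⁻ ω, F (servingArea fun n => X n ω) * expNeg (∑' n, negLog (u (discArea (X n ω)))) ∂P =
      ∫⁻ v in Set.Ioi 0, F v * (lam * u v * expNeg (lam * hazard u v)) := by
  have hw : Measurable fun ω => expNeg (∑' n, negLog (u (discArea (X n ω)))) :=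
    measurable_expNeg.comp (h.measurable_tsum (g := fun x => negLog (u (discArea x)))
      (by fun_prop))
  have hV : Measurable fun ω => servingArea fun n => X n ω :=
    measurable_servingArea.comp h.measurable_config
  have hm : Measurable (hazard u) := measurable_hazard u
  have hd : Measurable fun v => lam * u v * expNeg (lam * hazard u v) := by fun_prop
  -- The serving area under `W` (each configuration weighted by the product of `u` over its points)
  -- and the candidate density have the same tails, so the two finite measures agree.
  set W := P.withDensity fun ω => expNeg (∑' n, negLog (u (discArea (X n ω))))
  set m := W.map fun ω => servingArea fun n => X n ω with hmdef
  set D := (volume.restrict (Set.Ioi (0 : ℝ))).withDensity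
    fun v => lam * u v * expNeg (lam * hazard u v)
  have hmIoi : ∀ a, m (Set.Ioi a) = expNeg (lam * hazard u (max a 0)) := fun a => by
    rw [Measure.map_apply hV measurableSet_Ioi, withDensity_apply _ (hV measurableSet_Ioi)]
    exact h.setLIntegral_expNeg_tsum_negLog hu hu0 hu1 a
  have hDIoi : ∀ a, D (Set.Ioi a) = expNeg (lam * hazard u (max a 0)) := fun a => by
    rw [withDensity_apply _ measurableSet_Ioi, Measure.restrict_restrict measurableSet_Ioi,
      Set.Ioi_inter_Ioi]
    exact lintegral_mul_expNeg_hazard hu hu1 hΓ hlam (le_max_right a 0)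
  -- Areas are nonnegative, so the total mass is also a tail, at any negative level.
  have hmuniv : m Set.univ = m (Set.Ioi (-1)) := by
    rw [Measure.map_apply hV .univ, Measure.map_apply hV measurableSet_Ioi]
    congr 1
    ext ω
    simp only [Set.preimage_univ, Set.mem_univ, Set.mem_preimage, Set.mem_Ioi, true_iff]
    exact lt_of_lt_of_le (by norm_num) (discArea_nonneg _)
  have hDuniv : D Set.univ = D (Set.Ioi (-1)) := by
    rw [withDensity_apply _ .univ, withDensity_apply _ measurableSet_Ioi,
      Measure.restrict_restrict measurableSet_Ioi, Set.Ioi_inter_Ioi, Measure.restrict_univ]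
    norm_num
  have hmfin : IsFiniteMeasure m := ⟨by
    rw [hmuniv, hmIoi]; exact (expNeg_ne_top _).lt_top⟩
  have hDfin : IsFiniteMeasure D := ⟨by
    rw [hDuniv, hDIoi]; exact (expNeg_ne_top _).lt_top⟩
  have hmD : m = D := by
    refine Measure.ext_of_Iic _ _ fun a => ?_
    rw [← Set.compl_Ioi, measure_compl measurableSet_Ioi (measure_ne_top _ _),
      measure_compl measurableSet_Ioi (measure_ne_top _ _), hmuniv, hDuniv]
    simp_rw [hmIoi, hDIoi]
  calc _ = ∫⁻ v, F v ∂m := by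
        rw [lintegral_map hF hV]
        refine .trans ?_ (lintegral_withDensity_eq_lintegral_mul _ hw (hF.comp hV)).symm
        simp only [Pi.mul_apply, Function.comp_apply, mul_comm]
    _ = _ := by
        rw [hmD, lintegral_withDensity_eq_lintegral_mul _ hd hF]
        simp only [Pi.mul_apply, mul_comm]

end IsPoissonProcess

/-! ### Averaging over the marks -/

/-- Independence factorises the finite products, and the bound `C` allows dominated convergence to
the infinite one. Index `k`, later the serving station, carries `f` instead of an exponential.
Nonvanishing is needed because `negLog 0` takes the junk value `0`. -/
lemma lintegral_mul_expNeg_tsum_of_iIndepFun {Ω E : Type*} [MeasurableSpace Ω] [MeasurableSpace E]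
    {P : Measure Ω} {M : ℕ → Ω → E} (hM : ∀ n, Measurable (M n))
    (hind : iIndepFun M P) (k : ℕ) {f : E → ℝ≥0∞} (hf : Measurable f) {C : ℝ≥0∞} (hC : C ≠ ⊤)
    (hfC : ∀ e, f e ≤ C) {φ : ℕ → E → ℝ≥0∞} (hφ : ∀ n, Measurable (φ n))
    (hφ0 : ∀ n, ∫⁻ ω, expNeg (φ n (M n ω)) ∂P ≠ 0) :
    ∫⁻ ω, f (M k ω) * expNeg (∑' n, if n = k then 0 else φ n (M n ω)) ∂P =
      (∫⁻ ω, f (M k ω) ∂P) *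
        expNeg (∑' n, if n = k then 0 else negLog (∫⁻ ω, expNeg (φ n (M n ω)) ∂P)) := by
  have : IsProbabilityMeasure P := hind.isProbabilityMeasure
  set Y : ℕ → E → ℝ≥0∞ := fun n e => if n = k then f e else expNeg (φ n e) with hY
  have hYm : ∀ n, Measurable (Y n) := fun n => by
    rw [hY]
    by_cases hn : n = k
    · simpa [hn] using hf
    · simpa [hn, Function.comp_def] using measurable_expNeg.comp (hφ n)
  have hfac : ∀ (N : ℕ) (a : ℝ≥0∞) (b c : ℕ → ℝ≥0∞), k < N → (∀ n, n ≠ k → expNeg (b n) = c n) →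
      ∏ n ∈ Finset.range N, (if n = k then a else c n) =
        a * ∏ n ∈ Finset.range N, expNeg (if n = k then 0 else b n) := by
    intro N a b c hN hbc
    have h1 : ∀ n, (if n = k then a else c n) =
        (if n = k then a else 1) * expNeg (if n = k then 0 else b n) := fun n => by
      by_cases hn : n = k
      · simp [hn]
      · simp [hn, hbc n hn]
    simp_rw [h1]
    rw [Finset.prod_mul_distrib, Finset.prod_ite_eq' _ k (fun _ => a),
      if_pos (Finset.mem_range.2 hN)]
  have hind' : iIndepFun (fun n ω => Y n (M n ω)) P := hind.comp Y hYm
  have key : ∀ N, k < N →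
      ∫⁻ ω, f (M k ω) * ∏ n ∈ Finset.range N, expNeg (if n = k then 0 else φ n (M n ω)) ∂P =
        (∫⁻ ω, f (M k ω) ∂P) * ∏ n ∈ Finset.range N,
          expNeg (if n = k then 0 else negLog (∫⁻ ω, expNeg (φ n (M n ω)) ∂P)) := by
    intro N hN
    have h1 : ∀ ω, f (M k ω) * ∏ n ∈ Finset.range N, expNeg (if n = k then 0 else φ n (M n ω)) =
        ∏ n ∈ Finset.range N, Y n (M n ω) := fun ω => by
      rw [← hfac N _ _ (fun n => expNeg (φ n (M n ω))) hN (fun _ _ => rfl)]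
      refine Finset.prod_congr rfl fun n _ => ?_
      by_cases hn : n = k
      · subst hn; simp [hY]
      · simp [hY, hn]
    simp_rw [h1]
    rw [lintegral_prod_eq_prod_lintegral_of_indepFun _ _ hind' fun n => (hYm n).comp (hM n),
      ← hfac N _ _ (fun n => ∫⁻ ω, expNeg (φ n (M n ω)) ∂P) hN]
    · refine Finset.prod_congr rfl fun n _ => ?_
      by_cases hn : n = k
      · subst hn; simp [hY]
      · simp [hY, hn]
    · intro n _
      refine expNeg_negLog (hφ0 n) ?_
      exact (lintegral_mono fun ω => expNeg_le_one _).trans (by simp)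
  have hL : Tendsto (fun N => ∫⁻ ω, f (M k ω) *
      ∏ n ∈ Finset.range N, expNeg (if n = k then 0 else φ n (M n ω)) ∂P) atTop
      (𝓝 (∫⁻ ω, f (M k ω) * expNeg (∑' n, if n = k then 0 else φ n (M n ω)) ∂P)) := by
    refine tendsto_lintegral_of_dominated_convergence (fun _ => C) (fun N => ?_)
      (fun N => ae_of_all _ fun ω => ?_) (by simpa using hC) (ae_of_all _ fun ω => ?_)
    · refine (hf.comp (hM k)).mul (Finset.measurable_prod _ fun n _ => ?_)
      refine measurable_expNeg.comp ?_
      by_cases hn : n = k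
      · simp [hn]
      · simpa [hn, Function.comp_def] using (hφ n).comp (hM n)
    · exact (mul_le_mul' (hfC _) (Finset.prod_le_one' fun n _ => expNeg_le_one _)).trans
        (mul_one C).le
    · exact ENNReal.Tendsto.const_mul (tendsto_prod_expNeg _)
        (Or.inr ((hfC _).trans_lt hC.lt_top).ne)
  have hfi : ∫⁻ ω, f (M k ω) ∂P ≠ ⊤ :=
    ((lintegral_mono fun ω => hfC (M k ω)).trans_lt (by simpa using hC.lt_top)).ne
  refine tendsto_nhds_unique hL ((ENNReal.Tendsto.const_mul (tendsto_prod_expNeg _)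
    (Or.inr hfi)).congr' ?_)
  filter_upwards [eventually_gt_atTop k] with N hN
  rw [key N hN]

/-- The joint law is a product, so by Tonelli the marks can be averaged with the positions frozen.
-/
lemma _root_.ProbabilityTheory.IndepFun.lintegral_comp_prodMk {Ω A B : Type*} [MeasurableSpace Ω]
    [MeasurableSpace A] [MeasurableSpace B] {P : Measure Ω} [IsProbabilityMeasure P] {X : Ω → A}
    {M : Ω → B} (h : IndepFun X M P) (hX : Measurable X) (hM : Measurable M) {Ψ : A × B → ℝ≥0∞}
    (hΨ : Measurable Ψ) :
    ∫⁻ ω, Ψ (X ω, M ω) ∂P = ∫⁻ ω, ∫⁻ ω', Ψ (X ω, M ω') ∂P ∂P := by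
  have := Measure.isProbabilityMeasure_map (μ := P) hM.aemeasurable
  rw [← lintegral_map (f := Ψ) hΨ (hX.prodMk hM),
    (indepFun_iff_map_prod_eq_prod_map_map hX.aemeasurable hM.aemeasurable).1 h,
    lintegral_prod _ hΨ.aemeasurable, lintegral_map hΨ.lintegral_prod_right' hX]
  refine lintegral_congr fun ω => ?_
  rw [lintegral_map (by fun_prop) hM]

/-! ### Received power as a function of the disc area -/

/-- Radius of the disc of area `v`. -/
def discRadius (v : ℝ) : ℝ≥0 := Real.toNNReal (Real.sqrt (v / Real.pi))

@[fun_prop] lemma measurable_discRadius : Measurable discRadius := by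
  unfold discRadius; fun_prop

lemma discRadius_pi_mul_sq {r : ℝ} (hr : 0 ≤ r) : discRadius (Real.pi * r ^ 2) = r.toNNReal := by
  rw [discRadius, mul_div_cancel_left₀ _ Real.pi_pos.ne', Real.sqrt_sq hr]

lemma discRadius_discArea (x : Plane) : discRadius (discArea x) = ‖x‖₊ := by
  rw [discArea, discRadius_pi_mul_sq (norm_nonneg x), norm_toNNReal]

lemma tendsto_discRadius : Tendsto discRadius (𝓝[>] 0) (𝓝[>] 0) := by
  refine tendsto_nhdsWithin_iff.2 ⟨?_, ?_⟩
  · have h : Continuous discRadius := by unfold discRadius; fun_prop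
    have h0 : discRadius 0 = 0 := by simp [discRadius]
    exact (h0 ▸ h.tendsto 0).mono_left nhdsWithin_le_nhds
  · filter_upwards [self_mem_nhdsWithin] with v hv
    have hv : 0 < v := hv
    exact Real.toNNReal_pos.2 (by positivity)

lemma lintegral_Ioi_eq_lintegral_radius (f : ℝ → ℝ≥0∞) :
    ∫⁻ v in Set.Ioi (0 : ℝ), f v =
      ∫⁻ r in Set.Ioi (0 : ℝ), ENNReal.ofReal (2 * Real.pi * r) * f (Real.pi * r ^ 2) := by
  have himg : (fun r : ℝ => Real.pi * r ^ 2) '' Set.Ioi 0 = Set.Ioi 0 := by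
    ext v
    constructor
    · rintro ⟨r, hr, rfl⟩
      have hr : 0 < r := hr
      exact show 0 < Real.pi * r ^ 2 by positivity
    · intro hv
      have hv : 0 < v := hv
      refine ⟨Real.sqrt (v / Real.pi), show 0 < Real.sqrt (v / Real.pi) by positivity, ?_⟩
      dsimp only
      rw [Real.sq_sqrt (by positivity), mul_div_cancel₀ _ Real.pi_pos.ne']
  nth_rewrite 1 [← himg]
  rw [lintegral_image_eq_lintegral_abs_deriv_mul measurableSet_Ioi
    (f' := fun r => 2 * Real.pi * r)]
  · refine setLIntegral_congr_fun measurableSet_Ioi fun r hr => ?_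
    have hr : 0 < r := hr
    simp only [abs_of_pos (show 0 < 2 * Real.pi * r by positivity)]
  · intro r _
    have := ((hasDerivAt_pow 2 r).const_mul Real.pi).hasDerivWithinAt (s := Set.Ioi 0)
    convert! this using 1
    simp; ring
  · intro r hr r' hr' h
    have h1 : r ^ 2 = r' ^ 2 := mul_left_cancel₀ Real.pi_pos.ne' h
    exact (sq_eq_sq₀ (le_of_lt hr) (le_of_lt hr')).1 h1

lemma lintegral_Ioi_comp_div (f : ℝ → ℝ≥0∞) {c : ℝ≥0} (hc : 0 < c) :
    ∫⁻ v in Set.Ioi (0 : ℝ), f v = (c : ℝ≥0∞)⁻¹ * ∫⁻ w in Set.Ioi (0 : ℝ), f (w / c) := by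
  have hc' : (0 : ℝ) < c := hc
  have himg : (fun w : ℝ => w / c) '' Set.Ioi 0 = Set.Ioi 0 := by
    ext v
    constructor
    · rintro ⟨r, hr, rfl⟩
      have hr : 0 < r := hr
      exact show 0 < r / c by positivity
    · intro hv
      have hv : 0 < v := hv
      exact ⟨v * c, show 0 < v * c by positivity, mul_div_cancel_right₀ _ hc'.ne'⟩
  have h1 : (c : ℝ≥0∞)⁻¹ ≠ ⊤ := by simpa using hc.ne'
  rw [← lintegral_const_mul' _ _ h1]
  nth_rewrite 1 [← himg]
  rw [lintegral_image_eq_lintegral_abs_deriv_mul measurableSet_Ioi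
    (f' := fun _ => (c : ℝ)⁻¹)]
  · rw [abs_of_pos (inv_pos.2 hc'), ENNReal.ofReal_inv_of_pos hc', ENNReal.ofReal_coe_nnreal]
  · intro r _
    simpa [div_eq_mul_inv] using ((hasDerivAt_id r).div_const (c : ℝ)).hasDerivWithinAt
  · intro r _ r' _ h
    exact (div_left_inj' hc'.ne').1 h

section Gain

variable {S : Type*}

/-- Power received over a link with fading and state `p` from a base station on the boundary of
the disc of area `v`. -/
def gain (L : ℝ≥0 → S → ℝ≥0) (v : ℝ) (p : ℝ≥0 × S) : ℝ≥0∞ :=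
  (p.1 : ℝ≥0∞) * (L (discRadius v) p.2 : ℝ≥0∞)

lemma gain_ne_top (L : ℝ≥0 → S → ℝ≥0) (v : ℝ) (p : ℝ≥0 × S) : gain L v p ≠ ⊤ :=
  ENNReal.mul_ne_top ENNReal.coe_ne_top ENNReal.coe_ne_top

lemma rxPower_eq_gain (L : ℝ≥0 → S → ℝ≥0) (x : ℕ → Plane) (h : ℕ → ℝ≥0) (t : ℕ → S) (n : ℕ) :
    rxPower L x h t n = gain L (discArea (x n)) (h n, t n) := by
  rw [rxPower, gain, discRadius_discArea]

variable [MeasurableSpace S]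

/-- Laplace transform of the power received from the boundary of the disc of area `v`. -/
def gainLaplace (μ : Measure ℝ≥0) (ν : Measure S) (L : ℝ≥0 → S → ℝ≥0) (z : ℝ≥0∞) (v : ℝ) : ℝ≥0∞ :=
  ∫⁻ p, expNeg (z * gain L v p) ∂μ.prod ν

/-- `(1 - 𝔼 e^{-zg}) / z`, where `g` is the power received from the boundary of the disc of
area `v`. -/
def truncatedGain (μ : Measure ℝ≥0) (ν : Measure S) (L : ℝ≥0 → S → ℝ≥0) (z : ℝ≥0∞) (v : ℝ) :
    ℝ≥0∞ :=
  ∫⁻ p, gain L v p * avgExp (z * gain L v p) ∂μ.prod ν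

/-- Mean path loss on the boundary of the disc of area `v`. -/
def meanLoss (ν : Measure S) (L : ℝ≥0 → S → ℝ≥0) (v : ℝ) : ℝ≥0∞ :=
  ∫⁻ s, (L (discRadius v) s : ℝ≥0∞) ∂ν

variable {μ : Measure ℝ≥0} [IsProbabilityMeasure μ] {ν : Measure S} [IsProbabilityMeasure ν]
  {L : ℝ≥0 → S → ℝ≥0} {L₀ : ℝ≥0}

namespace IsFeasiblePathLoss

lemma measurable_gain (hL : IsFeasiblePathLoss ν L L₀) :
    Measurable fun q : ℝ × (ℝ≥0 × S) => gain L q.1 q.2 := by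
  have h : Measurable fun q : ℝ × (ℝ≥0 × S) => L (discRadius q.1) q.2.2 :=
    hL.measurable.comp (f := fun q : ℝ × (ℝ≥0 × S) => (discRadius q.1, q.2.2)) (by fun_prop)
  exact Measurable.mul (by fun_prop) h.coe_nnreal_ennreal

lemma measurable_gain_right (hL : IsFeasiblePathLoss ν L L₀) (v : ℝ) : Measurable (gain L v) :=
  hL.measurable_gain.comp measurable_prodMk_left

lemma measurable_loss (hL : IsFeasiblePathLoss ν L L₀) (r : ℝ≥0) : Measurable (L r) :=
  hL.measurable.comp measurable_prodMk_left

lemma measurable_gainLaplace (hL : IsFeasiblePathLoss ν L L₀) (z : ℝ≥0∞) :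
    Measurable (gainLaplace μ ν L z) := by
  have := hL.measurable_gain
  exact Measurable.lintegral_prod_right' (f := fun q : ℝ × (ℝ≥0 × S) => expNeg (z * gain L q.1 q.2))
    (by fun_prop)

lemma measurable_truncatedGain (hL : IsFeasiblePathLoss ν L L₀) :
    Measurable fun q : ℝ≥0∞ × ℝ => truncatedGain μ ν L q.1 q.2 := by
  have : Measurable fun q : (ℝ≥0∞ × ℝ) × (ℝ≥0 × S) => gain L q.1.2 q.2 :=
    hL.measurable_gain.comp (f := fun q : (ℝ≥0∞ × ℝ) × (ℝ≥0 × S) => (q.1.2, q.2)) (by fun_prop)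
  exact Measurable.lintegral_prod_right'
    (f := fun q : (ℝ≥0∞ × ℝ) × (ℝ≥0 × S) => gain L q.1.2 q.2 * avgExp (q.1.1 * gain L q.1.2 q.2))
    (by fun_prop)

lemma measurable_truncatedGain_right (hL : IsFeasiblePathLoss ν L L₀) (z : ℝ≥0∞) :
    Measurable (truncatedGain μ ν L z) :=
  hL.measurable_truncatedGain.comp measurable_prodMk_left

lemma gainLaplace_ne_zero (hL : IsFeasiblePathLoss ν L L₀) {z : ℝ≥0∞} (hz : z ≠ ⊤) (v : ℝ) :
    gainLaplace μ ν L z v ≠ 0 := by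
  have hm := hL.measurable_gain_right v
  intro h
  rw [gainLaplace, lintegral_eq_zero_iff (by fun_prop)] at h
  obtain ⟨p, hp⟩ := h.exists
  exact expNeg_ne_zero (ENNReal.mul_ne_top hz (gain_ne_top L v p)) hp

lemma gainLaplace_le_one (z : ℝ≥0∞) (v : ℝ) : gainLaplace μ ν L z v ≤ 1 :=
  (lintegral_mono fun _ => expNeg_le_one _).trans (by simp)

/-- This is `mul_avgExp` under the integral. It extracts the factor `z`, which at `z = t/λ` cancels
the intensity in the exponent. -/
lemma one_sub_gainLaplace (hL : IsFeasiblePathLoss ν L L₀) {z : ℝ≥0∞} (hz : z ≠ ⊤) (v : ℝ) :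
    1 - gainLaplace μ ν L z v = z * truncatedGain μ ν L z v := by
  have hm := hL.measurable_gain_right v
  have h1 : ∫⁻ p, (1 - expNeg (z * gain L v p)) ∂μ.prod ν = 1 - gainLaplace μ ν L z v := by
    rw [lintegral_sub (by fun_prop) ((gainLaplace_le_one z v).trans_lt ENNReal.one_lt_top).ne
      (ae_of_all _ fun _ => expNeg_le_one _)]
    simp [gainLaplace]
  rw [← h1, truncatedGain, ← lintegral_const_mul _ (by fun_prop)]
  refine lintegral_congr fun p => ?_
  rw [← mul_assoc, mul_avgExp (ENNReal.mul_ne_top hz (gain_ne_top L v p))]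

lemma truncatedGain_antitone (v : ℝ) : Antitone fun z => truncatedGain μ ν L z v :=
  fun _ _ h => lintegral_mono fun _ => mul_le_mul_right (avgExp_antitone (by gcongr)) _

lemma lintegral_gain (hL : IsFeasiblePathLoss ν L L₀) (hμ : ∫⁻ x, (x : ℝ≥0∞) ∂μ = 1) (v : ℝ) :
    ∫⁻ p, gain L v p ∂μ.prod ν = meanLoss ν L v := by
  have hm := hL.measurable_loss (discRadius v)
  unfold gain
  rw [lintegral_prod_mul (f := fun x : ℝ≥0 => (x : ℝ≥0∞))
    (g := fun s => (L (discRadius v) s : ℝ≥0∞)) (by fun_prop) (by fun_prop), hμ, one_mul, meanLoss]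

lemma truncatedGain_le_meanLoss (hL : IsFeasiblePathLoss ν L L₀)
    (hμ : ∫⁻ x, (x : ℝ≥0∞) ∂μ = 1) (z : ℝ≥0∞) (v : ℝ) :
    truncatedGain μ ν L z v ≤ meanLoss ν L v := by
  rw [← hL.lintegral_gain hμ v]
  exact lintegral_mono fun p => (mul_le_mul_right (avgExp_le_one _) _).trans (mul_one _).le

lemma meanLoss_le (hL : IsFeasiblePathLoss ν L L₀) (v : ℝ) : meanLoss ν L v ≤ L₀ := by
  refine (lintegral_mono_ae (g := fun _ => (L₀ : ℝ≥0∞)) ?_).trans (by simp)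
  filter_upwards [hL.le (discRadius v)] with s hs
  exact_mod_cast hs

/-- The factor `2π` of the final constant is the Jacobian `2πr` of `v = πr²`. -/
lemma lintegral_meanLoss (hL : IsFeasiblePathLoss ν L L₀) :
    ∫⁻ v in Set.Ioi (0 : ℝ), meanLoss ν L v = ENNReal.ofReal (2 * Real.pi) * gammaConst ν L := by
  have h : Measurable fun q : ℝ × S => (L (discRadius q.1) q.2 : ℝ≥0∞) :=
    (hL.measurable.comp (f := fun q : ℝ × S => (discRadius q.1, q.2)) (by fun_prop)).coe_nnreal_ennreal
  unfold meanLoss gammaConst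
  rw [lintegral_lintegral_swap h.aemeasurable, ← lintegral_const_mul' _ _ ENNReal.ofReal_ne_top]
  refine lintegral_congr fun s => ?_
  rw [lintegral_Ioi_eq_lintegral_radius, ← lintegral_const_mul' _ _ ENNReal.ofReal_ne_top]
  refine setLIntegral_congr_fun measurableSet_Ioi fun r hr => ?_
  have hr : 0 < r := hr
  rw [discRadius_pi_mul_sq hr.le, ENNReal.ofReal_mul (by positivity), mul_assoc]

lemma lintegral_meanLoss_ne_top (hL : IsFeasiblePathLoss ν L L₀) :
    ∫⁻ v in Set.Ioi (0 : ℝ), meanLoss ν L v ≠ ⊤ := by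
  rw [hL.lintegral_meanLoss]
  exact ENNReal.mul_ne_top ENNReal.ofReal_ne_top hL.gamma_lt_top.ne

lemma lintegral_one_sub_gainLaplace_ne_top (hL : IsFeasiblePathLoss ν L L₀)
    (hμ : ∫⁻ x, (x : ℝ≥0∞) ∂μ = 1) {z : ℝ≥0∞} (hz : z ≠ ⊤) :
    ∫⁻ v in Set.Ioi (0 : ℝ), (1 - gainLaplace μ ν L z v) ≠ ⊤ := by
  simp_rw [hL.one_sub_gainLaplace hz]
  rw [lintegral_const_mul' _ _ hz]
  exact ENNReal.mul_ne_top hz ((lintegral_mono fun v =>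
    hL.truncatedGain_le_meanLoss hμ z v).trans_lt hL.lintegral_meanLoss_ne_top.lt_top).ne

/-! ### Limits of the truncated gain -/

variable {ι : Type*} {l : Filter ι} [l.IsCountablyGenerated]

lemma tendsto_truncatedGain (hL : IsFeasiblePathLoss ν L L₀) (hμ : ∫⁻ x, (x : ℝ≥0∞) ∂μ = 1)
    (v : ℝ) {z : ι → ℝ≥0∞} (hz : Tendsto z l (𝓝 0)) :
    Tendsto (fun i => truncatedGain μ ν L (z i) v) l (𝓝 (meanLoss ν L v)) := by
  have hm := hL.measurable_gain_right v
  rw [← hL.lintegral_gain hμ v]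
  refine tendsto_lintegral_filter_of_dominated_convergence (gain L v)
    (Eventually.of_forall fun i => by fun_prop) (Eventually.of_forall fun i => ae_of_all _ fun p =>
      (mul_le_mul_right (avgExp_le_one _) _).trans (mul_one _).le) ?_ (ae_of_all _ fun p => ?_)
  · rw [hL.lintegral_gain hμ v]
    exact ((hL.meanLoss_le v).trans_lt ENNReal.coe_lt_top).ne
  · have h1 : Tendsto (fun i => z i * gain L v p) l (𝓝 (0 * gain L v p)) :=
      ENNReal.Tendsto.mul_const hz (Or.inr (gain_ne_top L v p))
    rw [zero_mul] at h1
    simpa using ENNReal.Tendsto.const_mul (a := gain L v p) (tendsto_avgExp_zero.comp h1)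
      (Or.inr (gain_ne_top L v p))

/-- Replacing the loss by its bound `L₀` inside the antitone `avgExp` decouples fading from link
state, with a fading factor that does not depend on `v`. -/
lemma mul_meanLoss_le_truncatedGain (hL : IsFeasiblePathLoss ν L L₀) (z : ℝ≥0∞) (v : ℝ) :
    (∫⁻ x : ℝ≥0, x * avgExp (z * (x * L₀)) ∂μ) * meanLoss ν L v ≤ truncatedGain μ ν L z v := by
  have hm := hL.measurable_loss (discRadius v)
  rw [meanLoss, ← lintegral_prod_mul (by fun_prop) (by fun_prop)]
  refine lintegral_mono_ae ?_
  filter_upwards [Measure.quasiMeasurePreserving_snd.ae (hL.le (discRadius v))] with p hp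
  have hp' : (L (discRadius v) p.2 : ℝ≥0∞) ≤ L₀ := by exact_mod_cast hp
  rw [mul_right_comm]
  exact mul_le_mul_right (avgExp_antitone (by unfold gain; gcongr)) _

/-- Here `v` moves along with `z`, so the limit at fixed `v` is not enough. The truncated gain is
squeezed between `meanLoss`, which tends to `L₀`, and `meanLoss` times a fading factor tending to
the mean fading `1`. -/
lemma tendsto_truncatedGain_zero (hL : IsFeasiblePathLoss ν L L₀)
    (hμ : ∫⁻ x, (x : ℝ≥0∞) ∂μ = 1)
    (hL_zero : Tendsto (fun r : ℝ≥0 => ∫⁻ s, (L r s : ℝ≥0∞) ∂ν) (𝓝[>] 0) (𝓝 (L₀ : ℝ≥0∞)))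
    {z : ι → ℝ≥0∞} (hz : Tendsto z l (𝓝 0)) {v : ι → ℝ} (hv : Tendsto v l (𝓝[>] 0)) :
    Tendsto (fun i => truncatedGain μ ν L (z i) (v i)) l (𝓝 L₀) := by
  have h1 : Tendsto (fun i => meanLoss ν L (v i)) l (𝓝 L₀) :=
    hL_zero.comp (tendsto_discRadius.comp hv)
  have h2 : Tendsto (fun i => ∫⁻ x : ℝ≥0, x * avgExp (z i * (x * L₀)) ∂μ) l (𝓝 1) := by
    rw [← hμ]
    refine tendsto_lintegral_filter_of_dominated_convergence (fun x => (x : ℝ≥0∞))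
      (Eventually.of_forall fun i => by fun_prop) (Eventually.of_forall fun i => ae_of_all _
        fun p => (mul_le_mul_right (avgExp_le_one _) _).trans (mul_one _).le) (by simp [hμ])
      (ae_of_all _ fun x => ?_)
    have h3 : Tendsto (fun i => z i * (x * L₀ : ℝ≥0∞)) l (𝓝 (0 * (x * L₀))) :=
      ENNReal.Tendsto.mul_const hz (Or.inr (by finiteness))
    rw [zero_mul] at h3
    simpa using ENNReal.Tendsto.const_mul (a := (x : ℝ≥0∞)) (tendsto_avgExp_zero.comp h3)
      (Or.inr ENNReal.coe_ne_top)
  have h3 := ENNReal.Tendsto.mul h2 (Or.inl one_ne_zero) h1 (Or.inr ENNReal.one_ne_top)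
  rw [one_mul] at h3
  exact tendsto_of_tendsto_of_tendsto_of_le_of_le h3 h1
    (fun i => hL.mul_meanLoss_le_truncatedGain _ _) fun i => hL.truncatedGain_le_meanLoss hμ _ _

end IsFeasiblePathLoss

end Gain

section Network

variable {S : Type*} [MeasurableSpace S] {μ : Measure ℝ≥0} [IsProbabilityMeasure μ]
  {ν : Measure S} [IsProbabilityMeasure ν] {L : ℝ≥0 → S → ℝ≥0} {L₀ : ℝ≥0}

/-! ### Measurability of the received powers -/

lemma IsFeasiblePathLoss.measurable_rxPower (hL : IsFeasiblePathLoss ν L L₀) (n : ℕ) :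
    Measurable fun c : (ℕ → Plane) × (ℕ → ℝ≥0 × S) =>
      rxPower L c.1 (fun n => (c.2 n).1) (fun n => (c.2 n).2) n := by
  simp_rw [rxPower_eq_gain]
  exact hL.measurable_gain.comp (f := fun c : (ℕ → Plane) × (ℕ → ℝ≥0 × S) =>
    (discArea (c.1 n), c.2 n)) (by fun_prop)

lemma IsFeasiblePathLoss.measurable_rxPower_servingIndex (hL : IsFeasiblePathLoss ν L L₀) :
    Measurable fun c : (ℕ → Plane) × (ℕ → ℝ≥0 × S) =>
      rxPower L c.1 (fun n => (c.2 n).1) (fun n => (c.2 n).2) (servingIndex c.1) :=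
  measurable_apply_index hL.measurable_rxPower (by fun_prop)

lemma IsFeasiblePathLoss.measurable_interference (hL : IsFeasiblePathLoss ν L L₀) :
    Measurable fun c : (ℕ → Plane) × (ℕ → ℝ≥0 × S) =>
      interference L c.1 (fun n => (c.2 n).1) (fun n => (c.2 n).2) := by
  refine Measurable.tsum fun n => ?_
  have hset : MeasurableSet {c : (ℕ → Plane) × (ℕ → ℝ≥0 × S) |
      ‖c.1 (servingIndex c.1)‖ < ‖c.1 n‖} :=
    measurableSet_lt ((measurable_apply_index (f := fun n (x : ℕ → Plane) => ‖x n‖)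
      (fun n => by fun_prop) measurable_servingIndex).comp measurable_fst) (by fun_prop)
  exact (hL.measurable_rxPower n).indicator hset

/-- With distinct distances, lying strictly outside the serving disc means being any other station.
-/
lemma interference_eq_tsum_ite {x : ℕ → Plane} (hinj : Function.Injective fun n => discArea (x n))
    (hx : ∃ n, ∀ m, ‖x n‖ ≤ ‖x m‖) (L : ℝ≥0 → S → ℝ≥0) (h : ℕ → ℝ≥0) (t : ℕ → S) :
    interference L x h t =
      ∑' n, if n = servingIndex x then 0 else gain L (discArea (x n)) (h n, t n) := by
  refine tsum_congr fun n => ?_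
  by_cases hn : n = servingIndex x
  · rw [if_pos hn, Set.indicator_of_notMem]
    exact fun (h : ‖x (servingIndex x)‖ < ‖x n‖) => h.ne (by rw [hn])
  · rw [if_neg hn, Set.indicator_of_mem, rxPower_eq_gain]
    refine show ‖x (servingIndex x)‖ < ‖x n‖ from discArea_lt_iff.1 (lt_of_le_of_ne
      (discArea_le_iff.2 (servingIndex_spec hx n)) fun h => hn (hinj h).symm)

/-! ### Joint transform of signal and interference -/

namespace IsNetwork

variable {Ω : Type*} [MeasurableSpace Ω] {P : Measure Ω} [IsProbabilityMeasure P] {lam : ℝ≥0}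
  {X : ℕ → Ω → Plane} {H : ℕ → Ω → ℝ≥0} {T : ℕ → Ω → S}

lemma measurable_mark (hN : IsNetwork P lam μ ν X H T) (n : ℕ) :
    Measurable fun ω => (H n ω, T n ω) :=
  (hN.measurable_fading n).prodMk (hN.measurable_state n)

lemma measurable_marks (hN : IsNetwork P lam μ ν X H T) : Measurable fun ω n => (H n ω, T n ω) :=
  measurable_pi_lambda _ hN.measurable_mark

lemma measurable_config (hN : IsNetwork P lam μ ν X H T) :
    Measurable fun ω => ((fun n => X n ω), fun n => (H n ω, T n ω)) :=
  hN.poisson.measurable_config.prodMk hN.measurable_marks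

lemma measurable_interference (hN : IsNetwork P lam μ ν X H T) (hL : IsFeasiblePathLoss ν L L₀) :
    Measurable fun ω => interference L (fun n => X n ω) (fun n => H n ω) (fun n => T n ω) := by
  have h := hL.measurable_interference.comp hN.measurable_config
  exact h

lemma measurable_signal (hN : IsNetwork P lam μ ν X H T) (hL : IsFeasiblePathLoss ν L L₀) :
    Measurable fun ω => rxPower L (fun n => X n ω) (fun n => H n ω) (fun n => T n ω)
      (servingIndex fun n => X n ω) := by
  have h := hL.measurable_rxPower_servingIndex.comp hN.measurable_config
  exact h

lemma lintegral_mark (hN : IsNetwork P lam μ ν X H T) (n : ℕ) {f : ℝ≥0 × S → ℝ≥0∞}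
    (hf : Measurable f) : ∫⁻ ω, f (H n ω, T n ω) ∂P = ∫⁻ p, f p ∂μ.prod ν := by
  rw [← hN.law_mark n, lintegral_map hf (hN.measurable_mark n)]

/-- Conditionally on the positions, the expectation of `f(h₀ L(r₀)) exp (-z I)`. -/
lemma lintegral_marks_mul_expNeg_interference (hN : IsNetwork P lam μ ν X H T)
    (hL : IsFeasiblePathLoss ν L L₀) {z : ℝ≥0∞} (hz : z ≠ ⊤) {f : ℝ≥0∞ → ℝ≥0∞}
    (hf : Measurable f) {C : ℝ≥0∞} (hC : C ≠ ⊤) (hfC : ∀ a, f a ≤ C) {x : ℕ → Plane}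
    (hinj : Function.Injective fun n => discArea (x n)) (hx : ∃ n, ∀ m, ‖x n‖ ≤ ‖x m‖) :
    ∫⁻ ω, f (rxPower L x (fun n => H n ω) (fun n => T n ω) (servingIndex x)) *
        expNeg (z * interference L x (fun n => H n ω) (fun n => T n ω)) ∂P =
      (∫⁻ p, f (gain L (servingArea x) p) ∂μ.prod ν) * (gainLaplace μ ν L z (servingArea x))⁻¹ *
        expNeg (∑' n, negLog (gainLaplace μ ν L z (discArea (x n)))) := by
  have hg := hL.measurable_gain_right
  set k := servingIndex x with hk
  have hkA : servingArea x = discArea (x k) := rfl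
  have hE : ∀ n, ∫⁻ ω, expNeg (z * gain L (discArea (x n)) (H n ω, T n ω)) ∂P =
      gainLaplace μ ν L z (discArea (x n)) := fun n =>
    hN.lintegral_mark n (f := fun p => expNeg (z * gain L (discArea (x n)) p))
      (by have := hg (discArea (x n)); fun_prop)
  have hu0 := fun v => hL.gainLaplace_ne_zero (μ := μ) hz v
  have hu1 := fun v => IsFeasiblePathLoss.gainLaplace_le_one (μ := μ) (ν := ν) (L := L) z v
  have h1 := lintegral_mul_expNeg_tsum_of_iIndepFun (P := P) hN.measurable_mark hN.indep_mark k
    (f := fun p => f (gain L (discArea (x k)) p)) (hf.comp (hg _)) hC (fun p => hfC _)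
    (φ := fun n p => z * gain L (discArea (x n)) p)
    (fun n => by have := hg (discArea (x n)); fun_prop) (fun n => by rw [hE]; exact hu0 _)
  simp_rw [hE] at h1
  rw [hN.lintegral_mark k (f := fun p => f (gain L (discArea (x k)) p)) (hf.comp (hg _))] at h1
  -- The interference omits the serving station. Its factor is put back, against a compensating
  -- inverse, so that the weight runs over all points as the Laplace functional requires.
  have h2 : expNeg (∑' n, negLog (gainLaplace μ ν L z (discArea (x n)))) =
      gainLaplace μ ν L z (discArea (x k)) * expNeg (∑' n, if n = k then 0 else
        negLog (gainLaplace μ ν L z (discArea (x n)))) := by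
    rw [ENNReal.tsum_eq_add_tsum_ite k, expNeg_add, expNeg_negLog (hu0 _) (hu1 _)]
    congr!
  rw [h2, hkA, ← mul_assoc, mul_assoc _ (gainLaplace μ ν L z (discArea (x k)))⁻¹,
    ENNReal.inv_mul_cancel (hu0 _) ((hu1 _).trans_lt ENNReal.one_lt_top).ne, mul_one, ← h1]
  refine lintegral_congr fun ω => ?_
  rw [interference_eq_tsum_ite hinj hx, ← ENNReal.tsum_mul_left, rxPower_eq_gain]
  simp_rw [mul_ite, mul_zero]
  rfl

/-- Joint Laplace transform of the interference with a function of the received signal power. -/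
lemma lintegral_mul_expNeg_interference (hN : IsNetwork P lam μ ν X H T) (hlam : 0 < lam)
    (hμ : ∫⁻ x, (x : ℝ≥0∞) ∂μ = 1) (hL : IsFeasiblePathLoss ν L L₀) {z : ℝ≥0∞} (hz : z ≠ ⊤)
    {f : ℝ≥0∞ → ℝ≥0∞} (hf : Measurable f) {C : ℝ≥0∞} (hC : C ≠ ⊤) (hfC : ∀ a, f a ≤ C) :
    ∫⁻ ω, f (rxPower L (fun n => X n ω) (fun n => H n ω) (fun n => T n ω)
          (servingIndex fun n => X n ω)) *
        expNeg (z * interference L (fun n => X n ω) (fun n => H n ω) (fun n => T n ω)) ∂P =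
      ∫⁻ v in Set.Ioi (0 : ℝ), (∫⁻ p, f (gain L v p) ∂μ.prod ν) *
        (lam * expNeg (lam * hazard (gainLaplace μ ν L z) v)) := by
  have hu0 := fun v => hL.gainLaplace_ne_zero (μ := μ) hz v
  have hu1 := fun v => IsFeasiblePathLoss.gainLaplace_le_one (μ := μ) (ν := ν) (L := L) z v
  have hu := hL.measurable_gainLaplace (μ := μ) z
  have hm1 := hL.measurable_rxPower_servingIndex
  have hm2 := hL.measurable_interference
  have hF : Measurable fun v => ∫⁻ p, f (gain L v p) ∂μ.prod ν :=
    (hf.comp hL.measurable_gain).lintegral_prod_right'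
  have hF' : Measurable fun v => (∫⁻ p, f (gain L v p) ∂μ.prod ν) * (gainLaplace μ ν L z v)⁻¹ :=
    hF.mul hu.inv
  have h1 := hN.indep_position.lintegral_comp_prodMk hN.poisson.measurable_config
    hN.measurable_marks (Ψ := fun c => f (rxPower L c.1 (fun n => (c.2 n).1) (fun n => (c.2 n).2)
      (servingIndex c.1)) * expNeg (z * interference L c.1 (fun n => (c.2 n).1)
      (fun n => (c.2 n).2))) (by fun_prop)
  have h2 := hN.poisson.lintegral_mul_expNeg_tsum_negLog hlam hu hu0 hu1
    (hL.lintegral_one_sub_gainLaplace_ne_top hμ hz) hF'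
  refine h1.trans (.trans ?_ (h2.trans ?_))
  · refine lintegral_congr_ae ?_
    filter_upwards [hN.poisson.ae_injective_discArea, hN.poisson.ae_exists_nearest] with ω hω hω'
    exact hN.lintegral_marks_mul_expNeg_interference hL hz hf hC hfC hω hω'
  -- The compensating inverse cancels the factor `u(v)` in the density of the weighted nearest area.
  · refine lintegral_congr fun v => ?_
    have h3 : (gainLaplace μ ν L z v)⁻¹ * gainLaplace μ ν L z v = 1 :=
      ENNReal.inv_mul_cancel (hu0 v) ((hu1 v).trans_lt ENNReal.one_lt_top).ne
    calc _ = (∫⁻ p, f (gain L v p) ∂μ.prod ν) * (lam * expNeg (lam *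
          hazard (gainLaplace μ ν L z) v)) * ((gainLaplace μ ν L z v)⁻¹ * gainLaplace μ ν L z v) := by
          ring
      _ = _ := by rw [h3, mul_one]

end IsNetwork

end Network

section Rescaled

variable {S : Type*} [MeasurableSpace S] {μ : Measure ℝ≥0} [IsProbabilityMeasure μ]
  {ν : Measure S} [IsProbabilityMeasure ν] {L : ℝ≥0 → S → ℝ≥0} {L₀ : ℝ≥0}

/-! ### Rescaled integral representations -/

/-- The exponent `λ (v + ∫_v^∞ (1 - 𝔼 e^{-zg}))` at `z = t / λ` and `v = w / λ`. -/
def scaledHazard (μ : Measure ℝ≥0) (ν : Measure S) (L : ℝ≥0 → S → ℝ≥0) (lam : ℝ≥0) (t w : ℝ) :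
    ℝ≥0∞ :=
  ENNReal.ofReal w + ENNReal.ofReal t *
    ∫⁻ y in Set.Ioi (w / lam), truncatedGain μ ν L (ENNReal.ofReal (t / lam)) y

/-- The integrand in the rescaled representation of the area spectral efficiency. -/
def scaledIntegrand (μ : Measure ℝ≥0) (ν : Measure S) (L : ℝ≥0 → S → ℝ≥0) (N₀ lam : ℝ≥0)
    (t w : ℝ) : ℝ≥0∞ :=
  expNeg (ENNReal.ofReal (t / lam) * N₀) *
    (truncatedGain μ ν L (ENNReal.ofReal (t / lam)) (w / lam) *
      expNeg (scaledHazard μ ν L lam t w))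

namespace IsFeasiblePathLoss

lemma mul_hazard_gainLaplace (hL : IsFeasiblePathLoss ν L L₀) {lam : ℝ≥0} (hlam : 0 < lam)
    (t w : ℝ) :
    lam * hazard (gainLaplace μ ν L (ENNReal.ofReal (t / lam))) (w / lam) =
      scaledHazard μ ν L lam t w := by
  have h : ∀ x : ℝ, (lam : ℝ≥0∞) * ENNReal.ofReal (x / lam) = ENNReal.ofReal x := fun x => by
    rw [← ENNReal.ofReal_coe_nnreal, ← ENNReal.ofReal_mul lam.coe_nonneg,
      mul_div_cancel₀ _ (by exact_mod_cast hlam.ne')]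
  unfold hazard scaledHazard
  simp_rw [hL.one_sub_gainLaplace ENNReal.ofReal_ne_top]
  rw [lintegral_const_mul' _ _ ENNReal.ofReal_ne_top, mul_add, ← mul_assoc, h, h]

/-- Each substitution, `z = t/λ` and `v = w/λ`, has Jacobian `1/λ`, cancelling the outer factor and
the one in the density. -/
lemma lintegral_rescale (hL : IsFeasiblePathLoss ν L L₀) {lam : ℝ≥0} (hlam : 0 < lam)
    (g : ℝ → ℝ≥0∞) (F : ℝ → ℝ → ℝ≥0∞) :
    lam * ∫⁻ z in Set.Ioi (0 : ℝ), g z * ∫⁻ v in Set.Ioi (0 : ℝ), F z v *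
        (lam * expNeg (lam * hazard (gainLaplace μ ν L (ENNReal.ofReal z)) v)) =
      ∫⁻ t in Set.Ioi (0 : ℝ), g (t / lam) * ∫⁻ w in Set.Ioi (0 : ℝ), F (t / lam) (w / lam) *
        expNeg (scaledHazard μ ν L lam t w) := by
  have hc : (lam : ℝ≥0∞) * (lam : ℝ≥0∞)⁻¹ = 1 :=
    ENNReal.mul_inv_cancel (by exact_mod_cast hlam.ne') ENNReal.coe_ne_top
  rw [lintegral_Ioi_comp_div _ hlam, ← mul_assoc, hc, one_mul]
  refine lintegral_congr fun t => ?_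
  congr 1
  rw [lintegral_Ioi_comp_div _ hlam, ← lintegral_const_mul' _ _ (by simpa using hlam.ne')]
  refine lintegral_congr fun w => ?_
  rw [hL.mul_hazard_gainLaplace hlam]
  calc _ = F (t / lam) (w / lam) * expNeg (scaledHazard μ ν L lam t w) * (lam * (lam : ℝ≥0∞)⁻¹) := by
        ring
    _ = _ := by rw [hc, mul_one]

lemma measurable_scaledHazard (hL : IsFeasiblePathLoss ν L L₀) (lam : ℝ≥0) :
    Measurable fun q : ℝ × ℝ => scaledHazard μ ν L lam q.1 q.2 := by
  have hset : MeasurableSet {q : (ℝ × ℝ) × ℝ | q.1.2 / lam < q.2} :=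
    measurableSet_lt (by fun_prop) (by fun_prop)
  have h1 : Measurable fun q : (ℝ × ℝ) × ℝ =>
      truncatedGain μ ν L (ENNReal.ofReal (q.1.1 / lam)) q.2 :=
    hL.measurable_truncatedGain.comp
      (f := fun q : (ℝ × ℝ) × ℝ => (ENNReal.ofReal (q.1.1 / lam), q.2)) (by fun_prop)
  have h2 := (h1.indicator hset).lintegral_prod_right' (ν := volume)
  have h3 : ∀ q : ℝ × ℝ, ∫⁻ y in Set.Ioi (q.2 / lam),
      truncatedGain μ ν L (ENNReal.ofReal (q.1 / lam)) y =
        ∫⁻ y, Set.indicator {q : (ℝ × ℝ) × ℝ | q.1.2 / lam < q.2} (fun q : (ℝ × ℝ) × ℝ =>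
          truncatedGain μ ν L (ENNReal.ofReal (q.1.1 / lam)) q.2) (q, y) := fun q => by
    rw [← lintegral_indicator measurableSet_Ioi]
    rfl
  unfold scaledHazard
  simp_rw [h3]
  fun_prop

lemma measurable_scaledIntegrand (hL : IsFeasiblePathLoss ν L L₀) (N₀ lam : ℝ≥0) :
    Measurable fun q : ℝ × ℝ => scaledIntegrand μ ν L N₀ lam q.1 q.2 := by
  have h1 := hL.measurable_scaledHazard (μ := μ) lam
  have h2 : Measurable fun q : ℝ × ℝ =>
      truncatedGain μ ν L (ENNReal.ofReal (q.1 / lam)) (q.2 / lam) :=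
    hL.measurable_truncatedGain.comp
      (f := fun q : ℝ × ℝ => (ENNReal.ofReal (q.1 / lam), q.2 / lam)) (by fun_prop)
  unfold scaledIntegrand
  fun_prop

end IsFeasiblePathLoss

namespace IsNetwork

variable {Ω : Type*} [MeasurableSpace Ω] {P : Measure Ω} [IsProbabilityMeasure P] {lam : ℝ≥0}
  {X : ℕ → Ω → Plane} {H : ℕ → Ω → ℝ≥0} {T : ℕ → Ω → S}

/-- Write `1/I = ∫₀^∞ e^{-zI} dz` and use the joint transform with `f = 1`. This links the moment
hypothesis to the integrability of the majorant. -/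
lemma mul_lintegral_inv_interference (hN : IsNetwork P lam μ ν X H T) (hlam : 0 < lam)
    (hμ : ∫⁻ x, (x : ℝ≥0∞) ∂μ = 1) (hL : IsFeasiblePathLoss ν L L₀) :
    lam * ∫⁻ ω, (interference L (fun n => X n ω) (fun n => H n ω) (fun n => T n ω))⁻¹ ∂P =
      ∫⁻ t in Set.Ioi (0 : ℝ), ∫⁻ w in Set.Ioi (0 : ℝ), expNeg (scaledHazard μ ν L lam t w) := by
  have hI := hN.measurable_interference hL
  have hm : Measurable fun q : Ω × ℝ => expNeg (ENNReal.ofReal q.2 *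
      interference L (fun n => X n q.1) (fun n => H n q.1) (fun n => T n q.1)) := by
    have := hI.comp (measurable_fst : Measurable (Prod.fst : Ω × ℝ → Ω))
    exact measurable_expNeg.comp (Measurable.mul (by fun_prop) this)
  simp_rw [← lintegral_expNeg_mul]
  rw [lintegral_lintegral_swap hm.aemeasurable]
  have h1 := fun z : ℝ => hN.lintegral_mul_expNeg_interference hlam hμ hL
    (ENNReal.ofReal_ne_top (r := z)) (f := fun _ => 1) measurable_const ENNReal.one_ne_top
    fun _ => le_rfl
  simp only [one_mul, lintegral_const, measure_univ] at h1
  simp_rw [h1]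
  simpa using hL.lintegral_rescale (μ := μ) hlam (fun _ => 1) (fun _ _ => 1)

/-- Frullani's formula with `b = I + N₀`. As the noise may vanish, `hpos` is what keeps `b` nonzero.
-/
lemma log_two_mul_averageASE (hN : IsNetwork P lam μ ν X H T) (hlam : 0 < lam)
    (hμ : ∫⁻ x, (x : ℝ≥0∞) ∂μ = 1) (hL : IsFeasiblePathLoss ν L L₀) (N₀ : ℝ≥0)
    (hpos : ∀ᵐ ω ∂P, interference L (fun n => X n ω) (fun n => H n ω) (fun n => T n ω) ≠ 0) :
    ENNReal.ofReal (Real.log 2) * averageASE P lam L N₀ X H T =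
      ∫⁻ t in Set.Ioi (0 : ℝ), ∫⁻ w in Set.Ioi (0 : ℝ), scaledIntegrand μ ν L N₀ lam t w := by
  set I : Ω → ℝ≥0∞ := fun ω => interference L (fun n => X n ω) (fun n => H n ω) fun n => T n ω
    with hIdef
  set A : Ω → ℝ≥0∞ := fun ω => rxPower L (fun n => X n ω) (fun n => H n ω) (fun n => T n ω)
    (servingIndex fun n => X n ω) with hAdef
  have hI : Measurable I := hN.measurable_interference hL
  have hA : Measurable A := hN.measurable_signal hL
  have hAtop : ∀ ω, A ω ≠ ⊤ := fun ω => by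
    rw [hAdef]
    simp only [rxPower_eq_gain]
    exact gain_ne_top _ _ _
  have hm : Measurable fun q : Ω × ℝ => expNeg (ENNReal.ofReal q.2 * (I q.1 + N₀)) *
      (A q.1 * avgExp (ENNReal.ofReal q.2 * A q.1)) := by fun_prop
  have hsignal : ∀ z : ℝ, 0 < z → ∫⁻ ω, A ω * avgExp (ENNReal.ofReal z * A ω) *
      expNeg (ENNReal.ofReal z * I ω) ∂P = ∫⁻ v in Set.Ioi (0 : ℝ),
        truncatedGain μ ν L (ENNReal.ofReal z) v *
          (lam * expNeg (lam * hazard (gainLaplace μ ν L (ENNReal.ofReal z)) v)) := fun z hz => by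
    have hz0 : ENNReal.ofReal z ≠ 0 := by simpa using hz
    -- The form `(1 - e^{-za}) / z` is visibly bounded by `1/z`, as the joint transform demands of
    -- `f`.
    have hf : ∀ a : ℝ≥0∞, a ≠ ⊤ → a * avgExp (ENNReal.ofReal z * a) =
        (ENNReal.ofReal z)⁻¹ * (1 - expNeg (ENNReal.ofReal z * a)) := fun a ha => by
      rw [← mul_avgExp (ENNReal.mul_ne_top ENNReal.ofReal_ne_top ha), mul_assoc, ← mul_assoc,
        ENNReal.inv_mul_cancel hz0 ENNReal.ofReal_ne_top, one_mul]
    have h1 := hN.lintegral_mul_expNeg_interference hlam hμ hL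
      (ENNReal.ofReal_ne_top (r := z)) (f := fun a => (ENNReal.ofReal z)⁻¹ *
        (1 - expNeg (ENNReal.ofReal z * a))) (by fun_prop) (ENNReal.inv_ne_top.2 hz0)
      fun a => (mul_le_mul_right tsub_le_self _).trans (mul_one _).le
    simp_rw [← hf _ (gain_ne_top L _ _)] at h1
    refine .trans (lintegral_congr fun ω => ?_) h1
    rw [hf _ (hAtop ω)]
  calc ENNReal.ofReal (Real.log 2) * averageASE P lam L N₀ X H T
      = lam * ∫⁻ ω, ENNReal.ofReal (Real.log 2) * spectralEfficiency (A ω / (I ω + N₀)) ∂P := by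
        rw [lintegral_const_mul' _ _ ENNReal.ofReal_ne_top, averageASE, mul_left_comm]
        rfl
    _ = lam * ∫⁻ ω, (∫⁻ z in Set.Ioi (0 : ℝ), expNeg (ENNReal.ofReal z * (I ω + N₀)) *
          (A ω * avgExp (ENNReal.ofReal z * A ω))) ∂P := by
        congr 1
        refine lintegral_congr_ae ?_
        filter_upwards [hpos] with ω hω
        rw [lintegral_expNeg_mul_avgExp (hAtop ω)]
        exact fun h => hω (add_eq_zero.1 h).1
    _ = lam * ∫⁻ z in Set.Ioi (0 : ℝ), expNeg (ENNReal.ofReal z * N₀) *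
          ∫⁻ v in Set.Ioi (0 : ℝ), truncatedGain μ ν L (ENNReal.ofReal z) v *
            (lam * expNeg (lam * hazard (gainLaplace μ ν L (ENNReal.ofReal z)) v)) := by
        rw [lintegral_lintegral_swap hm.aemeasurable]
        congr 1
        refine setLIntegral_congr_fun measurableSet_Ioi fun z hz => ?_
        rw [← hsignal z hz, ← lintegral_const_mul' _ _ (expNeg_ne_top _)]
        refine lintegral_congr fun ω => ?_
        rw [mul_add, expNeg_add]
        ring
    _ = _ := by
        rw [hL.lintegral_rescale hlam (fun z => expNeg (ENNReal.ofReal z * N₀))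
          (fun z v => truncatedGain μ ν L (ENNReal.ofReal z) v)]
        refine lintegral_congr fun t => ?_
        rw [← lintegral_const_mul' _ _ (expNeg_ne_top _)]
        rfl

end IsNetwork

/-! ### The limit of large densities -/

namespace IsFeasiblePathLoss

/-- Raising `λ` lowers `w/λ`, which enlarges the domain of integration, and lowers `t/λ`, which
raises the truncated gain. -/
lemma scaledHazard_mono {lam lam' : ℝ≥0} (hlam : 0 < lam) (hle : lam ≤ lam') {t w : ℝ}
    (ht : 0 ≤ t) (hw : 0 ≤ w) :
    scaledHazard μ ν L lam t w ≤ scaledHazard μ ν L lam' t w := by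
  have h0 : (0 : ℝ) < lam := hlam
  have h1 : (lam : ℝ) ≤ lam' := hle
  unfold scaledHazard
  refine add_le_add le_rfl (mul_le_mul_right ?_ _)
  exact (lintegral_mono_set (Set.Ioi_subset_Ioi (by gcongr))).trans (lintegral_mono fun y =>
    truncatedGain_antitone (μ := μ) (ν := ν) (L := L) y (by gcongr))

lemma tendsto_ofReal_div (t : ℝ) :
    Tendsto (fun lam : ℝ≥0 => ENNReal.ofReal (t / lam)) atTop (𝓝 0) := by
  have h : Tendsto (fun lam : ℝ≥0 => t / (lam : ℝ)) atTop (𝓝 0) :=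
    tendsto_const_nhds.div_atTop (NNReal.tendsto_coe_atTop.2 tendsto_id)
  simpa using ENNReal.tendsto_ofReal h

lemma tendsto_scaledHazard (hL : IsFeasiblePathLoss ν L L₀) (hμ : ∫⁻ x, (x : ℝ≥0∞) ∂μ = 1)
    (t : ℝ) {w : ℝ} (hw : 0 < w) :
    Tendsto (fun lam => scaledHazard μ ν L lam t w) atTop
      (𝓝 (ENNReal.ofReal w + ENNReal.ofReal t * ∫⁻ v in Set.Ioi (0 : ℝ), meanLoss ν L v)) := by
  refine tendsto_const_nhds.add (ENNReal.Tendsto.const_mul ?_ (Or.inr ENNReal.ofReal_ne_top))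
  have h1 : ∀ lam : ℝ≥0, ∫⁻ y in Set.Ioi (w / lam),
      truncatedGain μ ν L (ENNReal.ofReal (t / lam)) y = ∫⁻ y in Set.Ioi (0 : ℝ),
        (Set.Ioi (w / (lam : ℝ))).indicator (truncatedGain μ ν L (ENNReal.ofReal (t / lam))) y := by
    intro lam
    rw [lintegral_indicator measurableSet_Ioi, Measure.restrict_restrict measurableSet_Ioi,
      Set.Ioi_inter_Ioi, sup_of_le_left (by positivity)]
  simp_rw [h1]
  refine tendsto_lintegral_filter_of_dominated_convergence (meanLoss ν L)
    (Eventually.of_forall fun lam =>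
      (hL.measurable_truncatedGain_right _).indicator measurableSet_Ioi)
    (Eventually.of_forall fun lam => ae_of_all _ fun y =>
      (Set.indicator_le_self' (fun _ _ => zero_le) y).trans (hL.truncatedGain_le_meanLoss hμ _ y))
    hL.lintegral_meanLoss_ne_top ?_
  filter_upwards [ae_restrict_mem measurableSet_Ioi] with y hy
  have hy : 0 < y := hy
  refine (hL.tendsto_truncatedGain hμ y (tendsto_ofReal_div t)).congr' ?_
  have h : Tendsto (fun lam : ℝ≥0 => w / (lam : ℝ)) atTop (𝓝 0) :=
    tendsto_const_nhds.div_atTop (NNReal.tendsto_coe_atTop.2 tendsto_id)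
  filter_upwards [h.eventually_lt_const hy] with lam hlam
  rw [Set.indicator_of_mem]
  exact hlam

lemma tendsto_scaledIntegrand (hL : IsFeasiblePathLoss ν L L₀) (hμ : ∫⁻ x, (x : ℝ≥0∞) ∂μ = 1)
    (hL_zero : Tendsto (fun r : ℝ≥0 => ∫⁻ s, (L r s : ℝ≥0∞) ∂ν) (𝓝[>] 0) (𝓝 (L₀ : ℝ≥0∞)))
    (N₀ : ℝ≥0) (t : ℝ) {w : ℝ} (hw : 0 < w) :
    Tendsto (fun lam => scaledIntegrand μ ν L N₀ lam t w) atTop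
      (𝓝 (L₀ * expNeg (ENNReal.ofReal w +
        ENNReal.ofReal t * ∫⁻ v in Set.Ioi (0 : ℝ), meanLoss ν L v))) := by
  have h1 : Tendsto (fun lam : ℝ≥0 => expNeg (ENNReal.ofReal (t / lam) * N₀)) atTop (𝓝 1) := by
    have h := (continuous_expNeg.tendsto _).comp
      (ENNReal.Tendsto.mul_const (b := (N₀ : ℝ≥0∞)) (tendsto_ofReal_div t)
        (Or.inr ENNReal.coe_ne_top))
    simpa [Function.comp_def] using h
  have hv : Tendsto (fun lam : ℝ≥0 => w / (lam : ℝ)) atTop (𝓝[>] 0) := by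
    refine tendsto_nhdsWithin_iff.2
      ⟨tendsto_const_nhds.div_atTop (NNReal.tendsto_coe_atTop.2 tendsto_id), ?_⟩
    filter_upwards [eventually_gt_atTop 0] with lam hlam
    have : (0 : ℝ) < lam := hlam
    exact show 0 < w / (lam : ℝ) by positivity
  have h2 := hL.tendsto_truncatedGain_zero hμ hL_zero (tendsto_ofReal_div t) hv
  have h3 := (continuous_expNeg.tendsto _).comp (hL.tendsto_scaledHazard hμ t hw)
  have h4 := ENNReal.Tendsto.mul h1 (Or.inl one_ne_zero) (ENNReal.Tendsto.mul h2
    (Or.inr (expNeg_ne_top _)) h3 (Or.inr ENNReal.coe_ne_top)) (Or.inr ENNReal.one_ne_top)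
  rwa [one_mul] at h4

lemma tendsto_lintegral_scaledIntegrand (hL : IsFeasiblePathLoss ν L L₀)
    (hμ : ∫⁻ x, (x : ℝ≥0∞) ∂μ = 1)
    (hL_zero : Tendsto (fun r : ℝ≥0 => ∫⁻ s, (L r s : ℝ≥0∞) ∂ν) (𝓝[>] 0) (𝓝 (L₀ : ℝ≥0∞)))
    (N₀ : ℝ≥0) {lam₁ : ℝ≥0} (hlam₁ : 0 < lam₁)
    (hfin : ∫⁻ t in Set.Ioi (0 : ℝ), ∫⁻ w in Set.Ioi (0 : ℝ),
      expNeg (scaledHazard μ ν L lam₁ t w) ≠ ⊤) :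
    Tendsto (fun lam => ∫⁻ t in Set.Ioi (0 : ℝ), ∫⁻ w in Set.Ioi (0 : ℝ),
      scaledIntegrand μ ν L N₀ lam t w) atTop
      (𝓝 (L₀ * (∫⁻ v in Set.Ioi (0 : ℝ), meanLoss ν L v)⁻¹)) := by
  set Γ := ∫⁻ v in Set.Ioi (0 : ℝ), meanLoss ν L v
  set ρ : Measure ℝ := volume.restrict (Set.Ioi 0)
  have hmH := hL.measurable_scaledHazard (μ := μ) lam₁
  have hmem : ∀ᵐ q ∂ρ.prod ρ, 0 < q.1 ∧ 0 < q.2 := by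
    have h : ∀ᵐ t ∂ρ, 0 < t := ae_restrict_mem measurableSet_Ioi
    filter_upwards [Measure.quasiMeasurePreserving_fst.ae h,
      Measure.quasiMeasurePreserving_snd.ae h] with q h1 h2 using ⟨h1, h2⟩
  have hlim : Tendsto (fun lam => ∫⁻ q, scaledIntegrand μ ν L N₀ lam q.1 q.2 ∂ρ.prod ρ) atTop
      (𝓝 (∫⁻ q, L₀ * expNeg (ENNReal.ofReal q.2 + ENNReal.ofReal q.1 * Γ) ∂ρ.prod ρ)) := by
    -- The majorant is the value at the single intensity `lam₁`, with the truncated gain bounded by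
    -- `L₀` and the noise factor by `1`.
    refine tendsto_lintegral_filter_of_dominated_convergence
      (fun q => L₀ * expNeg (scaledHazard μ ν L lam₁ q.1 q.2))
      (Eventually.of_forall fun lam => hL.measurable_scaledIntegrand N₀ lam) ?_ ?_ ?_
    · filter_upwards [eventually_ge_atTop lam₁] with lam hlam
      filter_upwards [hmem] with q hq
      refine (mul_le_mul' (expNeg_le_one _) (mul_le_mul'
        ((hL.truncatedGain_le_meanLoss hμ _ _).trans (hL.meanLoss_le _))
        (expNeg_antitone (scaledHazard_mono hlam₁ hlam hq.1.le hq.2.le)))).trans (one_mul _).le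
    · rw [lintegral_const_mul' _ _ ENNReal.coe_ne_top, lintegral_prod _ (by fun_prop)]
      exact ENNReal.mul_ne_top ENNReal.coe_ne_top hfin
    · filter_upwards [hmem] with q hq
      exact hL.tendsto_scaledIntegrand hμ hL_zero N₀ q.1 hq.2
  have hval : ∫⁻ q, L₀ * expNeg (ENNReal.ofReal q.2 + ENNReal.ofReal q.1 * Γ) ∂ρ.prod ρ =
      L₀ * Γ⁻¹ := by
    rw [lintegral_const_mul' _ _ ENNReal.coe_ne_top]
    congr 1
    have h1 : ∀ q : ℝ × ℝ, expNeg (ENNReal.ofReal q.2 + ENNReal.ofReal q.1 * Γ) =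
        expNeg (ENNReal.ofReal q.1 * Γ) * expNeg (ENNReal.ofReal q.2 * 1) := fun q => by
      rw [mul_one, add_comm, expNeg_add]
    simp_rw [h1]
    rw [lintegral_prod_mul (f := fun t : ℝ => expNeg (ENNReal.ofReal t * Γ))
      (g := fun w : ℝ => expNeg (ENNReal.ofReal w * 1)) (by fun_prop) (by fun_prop),
      lintegral_expNeg_mul, lintegral_expNeg_mul, inv_one, mul_one]
  rw [hval] at hlim
  refine hlim.congr fun lam => ?_
  rw [lintegral_prod _ (hL.measurable_scaledIntegrand N₀ lam).aemeasurable]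

end IsFeasiblePathLoss

/-! ### The constant and the conclusion -/

lemma inv_mul_inv_eq_ofReal {l : ℝ≥0} {b γ : ℝ≥0∞} {c : ℝ} (hc : 0 < c) (h0 : 0 < γ) (h1 : γ < ⊤)
    (hb : b = ENNReal.ofReal (2 * Real.pi) * γ) :
    (ENNReal.ofReal c)⁻¹ * (l * b⁻¹) = ENNReal.ofReal (l / (2 * Real.pi * c * γ.toReal)) := by
  have hγ : 0 < γ.toReal := ENNReal.toReal_pos h0.ne' h1.ne
  have hb' : b = ENNReal.ofReal (2 * Real.pi * γ.toReal) := by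
    rw [hb, ENNReal.ofReal_mul (p := 2 * Real.pi) (by positivity), ENNReal.ofReal_toReal h1.ne]
  rw [hb', ← ENNReal.ofReal_inv_of_pos hc, ← ENNReal.ofReal_inv_of_pos (by positivity),
    ← ENNReal.ofReal_coe_nnreal, ← ENNReal.ofReal_mul l.coe_nonneg,
    ← ENNReal.ofReal_mul (by positivity)]
  congr 1
  field_simp

lemma le_one_add_sq (a : ℝ≥0∞) : a ≤ 1 + a ^ 2 := by
  rcases le_total a 1 with h | h
  · exact h.trans le_self_add
  · exact (le_self_pow₀ h two_ne_zero).trans le_add_self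

end Rescaled

end Ultradense

end

theorem theorem1 {Ω S : Type*} [MeasurableSpace Ω] [MeasurableSpace S]
    (P : Measure Ω) [IsProbabilityMeasure P]
    (μ : Measure ℝ≥0) [IsProbabilityMeasure μ] (hμ : ∫⁻ x, (x : ℝ≥0∞) ∂μ = 1)
    (ν : Measure S) [IsProbabilityMeasure ν]
    (L : ℝ≥0 → S → ℝ≥0) (L₀ : ℝ≥0) (hL : Ultradense.IsFeasiblePathLoss ν L L₀)
    (hL_zero : Tendsto (fun r : ℝ≥0 => ∫⁻ s, (L r s : ℝ≥0∞) ∂ν) (𝓝[>] 0) (𝓝 (L₀ : ℝ≥0∞)))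
    (N₀ : ℝ≥0)
    (X : ℝ≥0 → ℕ → Ω → Ultradense.Plane) (H : ℝ≥0 → ℕ → Ω → ℝ≥0) (T : ℝ≥0 → ℕ → Ω → S)
    (hnet : ∀ lam : ℝ≥0, 0 < lam → Ultradense.IsNetwork P lam μ ν (X lam) (H lam) (T lam))
    (lamc : ℝ≥0)
    (hI : ∀ lam₀ : ℝ≥0, 0 < lam₀ → lamc ≤ lam₀ →
      Ultradense.secondNegativeMoment P L (X lam₀) (H lam₀) (T lam₀) < ⊤) :
    Tendsto (fun lam : ℝ≥0 => Ultradense.averageASE P lam L N₀ (X lam) (H lam) (T lam)) atTop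
      (𝓝 (ENNReal.ofReal
        ((L₀ : ℝ) / (2 * Real.pi * Real.log 2 * (Ultradense.gammaConst ν L).toReal)))) := by

  have hc : 0 < Real.log 2 := Real.log_pos one_lt_two
  have hc0 : ENNReal.ofReal (Real.log 2) ≠ 0 := by simpa using hc
  -- Since `0⁻¹ = ⊤`, a finite negative moment forbids vanishing interference with positive
  -- probability.
  have hneg : ∀ lam : ℝ≥0, 0 < lam → lamc ≤ lam → ∀ᵐ ω ∂P,
      Ultradense.interference L (fun n => X lam n ω) (fun n => H lam n ω)
        (fun n => T lam n ω) ≠ 0 := fun lam h0 hle => by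
    have hm := (hnet lam h0).measurable_interference hL
    have h := hI lam h0 hle
    rw [Ultradense.secondNegativeMoment] at h
    filter_upwards [ae_lt_top (by fun_prop) h.ne] with ω hω h0
    rw [h0] at hω
    simp at hω
  -- The maximum with `1` keeps the reference intensity positive when `lamc = 0`.
  set lam₁ : ℝ≥0 := max lamc 1 with hlam₁
  have hpos₁ : 0 < lam₁ := lt_max_of_lt_right one_pos
  have hfin : ∫⁻ t in Set.Ioi (0 : ℝ), ∫⁻ w in Set.Ioi (0 : ℝ),
      Ultradense.expNeg (Ultradense.scaledHazard μ ν L lam₁ t w) ≠ ⊤ := by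
    rw [← (hnet lam₁ hpos₁).mul_lintegral_inv_interference hpos₁ hμ hL]
    -- On a probability space `I⁻¹ ≤ 1 + I⁻²` bounds the first negative moment by the second.
    refine ENNReal.mul_ne_top ENNReal.coe_ne_top (ne_top_of_le_ne_top ?_
      (lintegral_mono fun ω => Ultradense.le_one_add_sq _))
    rw [lintegral_add_left measurable_const, lintegral_const, measure_univ, mul_one]
    exact ENNReal.add_ne_top.2 ⟨ENNReal.one_ne_top, (hI lam₁ hpos₁ (le_max_left _ _)).ne⟩
  have hlim := ENNReal.Tendsto.const_mul (a := (ENNReal.ofReal (Real.log 2))⁻¹)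
    (hL.tendsto_lintegral_scaledIntegrand hμ hL_zero N₀ hpos₁ hfin)
    (Or.inr (ENNReal.inv_ne_top.2 hc0))
  rw [Ultradense.inv_mul_inv_eq_ofReal hc hL.gamma_pos hL.gamma_lt_top hL.lintegral_meanLoss]
    at hlim
  refine hlim.congr' ?_
  filter_upwards [eventually_ge_atTop lam₁] with lam hlam
  have h0 : 0 < lam := hpos₁.trans_le hlam
  rw [← (hnet lam h0).log_two_mul_averageASE h0 hμ hL N₀
    (hneg lam h0 ((le_max_left _ _).trans hlam)), ← mul_assoc,
    ENNReal.inv_mul_cancel hc0 ENNReal.ofReal_ne_top, one_mul]
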